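/- Let $\mathcal{A} \subset \mathbb{R}$ be a set with exactly two elements. A partial word over $\mathcal{A}$ is an element of $(\mathcal{A} \cup \{?\})^{\mathbb{Z}}$. For $n \ge 2$, $0 \le l < n$ and a word $\varpi \in \mathcal{A}^{n-1}$, let $\beta^{(\varpi,n,l)}$ be the $n$-periodic partial word whose restriction to $[l+1,l+n]$ is $\varpi\,?$. If $\alpha$ is a partial word whose set of positions of $?$ is $n\mathbb{Z}+l$ and $\gamma$ is a partial word, then $\alpha \lhd \gamma$ is the partial word that equals $\alpha(x)$ for $x \notin n\mathbb{Z}+l$ and $\gamma((x-l)/n)$ for $x \in n\mathbb{Z}+l$. Given a sequence $\{(\varpi^{(k)},n_k,l_k)\}_{k \ge 1}$ of such triples, let $\beta_m = \beta^{(\varpi^{(1)},n_1,l_1)} \lhd \cdots \lhd \beta^{(\varpi^{(m)},n_m,l_m)}$, let $\beta_\infty = \lim_{m\to\infty} \beta_m$ (pointwise), and let $D_\infty$ be the set of positions of $?$ in $\beta_\infty$. A Toeplitz word over $\mathcal{A}$ is a non-periodic sequence in $\mathcal{A}^{\mathbb{Z}}$ that is either such a limit $\beta_\infty$ with $D_\infty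 = \emptyset$, or obtained from such a limit with $D_\infty \ne \emptyset$ by filling $D_\infty$ with a letter that occurs in $\varpi^{(k)}$ for infinitely many $k$. A sequence $V \in \mathcal{A}^{\mathbb{Z}}$ is called pattern Sturmian if it is recurrent and aperiodic and its maximal pattern complexity $$p^*(n) = \sup_{0 = \tau(0) < \tau(1) < \cdots < \tau(n-1)} \#\{ V(m+\tau(0)) V(m+\tau(1)) \cdots V(m+\tau(n-1)) : m \in \mathbb{Z} \}$$ satisfies $p^*(n) = 2n$ for every $n \ge 1$. Let $\beta$ be a Toeplitz word over $\mathcal{A}$ that is pattern Sturmian, and let $\Omega$ be the closure, in the product topology of $\mathcal{A}^{\mathbb{Z}}$, of the orbit of $\beta$ under the shift. Then for every $\omega \in \Omega$, the discrete Schrödinger operator $$[H_\omega \psi](n) = \psi(n+1) + \psi(n-1) + \omega(n)\psi(n)$$ on $\ell^2(\mathbb{Z})$ has empty point spectrum, that is, it has no eigenvalues. -/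

import Mathlib

open Filter
open scoped ENNReal

/-! ### Two-sided sequences -/

/-- `x` has no nonzero period. -/
def IsAperiodic {A : Type*} (x : ℤ → A) : Prop :=
  ∀ p : ℤ, p ≠ 0 → ∃ i, x (i + p) ≠ x i

/-- Every finite word occurring in `x` occurs in `x` at infinitely many positions. -/
def IsRecurrent {A : Type*} (x : ℤ → A) : Prop :=
  ∀ (i : ℤ) (k : ℕ), {m : ℤ | ∀ j : ℕ, j < k → x (m + j) = x (i + j)}.Infinite

/-- The set of words `x (m + τ 0) x (m + τ 1) ⋯ x (m + τ (n-1))`, `m ∈ ℤ`. -/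
def patternWords {A : Type*} (x : ℤ → A) {n : ℕ} (τ : Fin n → ℕ) : Set (Fin n → A) :=
  Set.range fun (m : ℤ) (j : Fin n) => x (m + (τ j : ℤ))

/-- The maximal pattern complexity `p*(n)`: the supremum of the number of words
`x (m + τ 0) ⋯ x (m + τ (n-1))` over all `0 = τ 0 < τ 1 < ⋯ < τ (n-1)`. -/
noncomputable def maxPatternComplexity {A : Type*} (x : ℤ → A) (n : ℕ) : ℕ∞ :=
  ⨆ τ : {τ : Fin n → ℕ // StrictMono τ ∧ ∀ h : 0 < n, τ ⟨0, h⟩ = 0},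
    (patternWords x τ.1).encard

/-- Recurrent aperiodic sequences with `p*(n) = 2 n` for every `n ≥ 1`. -/
def IsPatternSturmian {A : Type*} (x : ℤ → A) : Prop :=
  IsRecurrent x ∧ IsAperiodic x ∧ ∀ n : ℕ, 1 ≤ n → maxPatternComplexity x n = ((2 * n : ℕ) : ℕ∞)

/-! ### Toeplitz words

A partial word over `A` is a map `ℤ → Option A`; the value `none` is the symbol `?`. -/

/-- The partial word of period `n = |w| + 1` whose restriction to `[l + 1, l + n]` is `w ?`;
its undetermined part is `n ℤ + l`. -/
def periodicPartialWord {A : Type*} (w : List A) (l : ℤ) : ℤ → Option A :=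
  fun x => w[((x - l - 1) % ((w.length : ℤ) + 1)).toNat]?

/-- The composition `α ◁ β`, where the undetermined part of `α` is `n ℤ + l`. -/
def composePartialWords {A : Type*} (n l : ℤ) (α β : ℤ → Option A) : ℤ → Option A :=
  fun x => if n ∣ x - l then β ((x - l) / n) else α x

/-- A sequence of triples `(ϖ_k, n_k, l_k)`, here indexed by `k ≥ 0`, with `n_k ≥ 2`,
`|ϖ_k| = n_k - 1` and `0 ≤ l_k < n_k`. The number `n_k` is recorded as `|ϖ_k| + 1`. -/
structure ToeplitzCoding (A : Type*) where
  /-- the words `ϖ_k` -/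
  word : ℕ → List A
  /-- the offsets `l_k` -/
  offset : ℕ → ℕ
  word_ne_nil : ∀ k, word k ≠ []
  offset_lt : ∀ k, offset k < (word k).length + 1

namespace ToeplitzCoding

variable {A : Type*} (c : ToeplitzCoding A)

/-- `n_k`, the period of the `k`-th partial word. -/
def period (k : ℕ) : ℕ := (c.word k).length + 1

/-- `n_0 n_1 ⋯ n_{m-1}`, the period of the composition of the first `m` partial words. -/
def totalPeriod (m : ℕ) : ℕ := ∏ i ∈ Finset.range m, c.period i

/-- `∑_{i < m} n_0 ⋯ n_{i-1} l_i`. -/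
def totalOffset (m : ℕ) : ℕ := ∑ i ∈ Finset.range m, c.totalPeriod i * c.offset i

/-- The composition of the first `m` partial words (for `m = 0`: the word `⋯ ? ? ? ⋯`). -/
def partialWord : ℕ → ℤ → Option A
  | 0 => fun _ => none
  | m + 1 => composePartialWords (c.totalPeriod m) (c.totalOffset m) (partialWord m)
      (periodicPartialWord (c.word m) (c.offset m))

/-- The undetermined part of the composition of the first `m` partial words. -/
def holes (m : ℕ) : Set ℤ := {x | c.partialWord m x = none}

/-- `⋂ m, D_m`, the positions that are never filled. -/
def limitHoles : Set ℤ := ⋂ m, c.holes m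

/-- `α` is the (pointwise) limit of the compositions of the first `m` partial words. -/
def IsLimitWord (α : ℤ → Option A) : Prop := ∀ x, ∀ᶠ m in atTop, c.partialWord m x = α x

/-- The letters that occur in `ϖ_k` for infinitely many `k`. -/
def recurrentLetters : Set A := {a | ∃ᶠ k in atTop, a ∈ c.word k}

/-- `β` is the normal Toeplitz word with coding `c`. -/
def IsNormalToeplitz (β : ℤ → A) : Prop :=
  c.limitHoles = ∅ ∧ c.IsLimitWord (fun x => some (β x)) ∧ IsAperiodic β

/-- `β` is an extended Toeplitz word with coding `c`: the limit word still has an undetermined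
position, which is filled with a recurrent letter. -/
def IsExtendedToeplitz (β : ℤ → A) : Prop :=
  c.limitHoles.Nonempty ∧ ∃ a ∈ c.recurrentLetters, ∃ α : ℤ → Option A,
    c.IsLimitWord α ∧ (∀ x, β x = (α x).getD a) ∧ IsAperiodic β

end ToeplitzCoding

/-- Toeplitz words over `A`: normal and extended ones. -/
def IsToeplitzWord {A : Type*} (β : ℤ → A) : Prop :=
  ∃ c : ToeplitzCoding A, c.IsNormalToeplitz β ∨ c.IsExtendedToeplitz β

/-- The closure of the orbit of `β` under the left shift, in the product topology. -/
def subshift {A : Type*} [TopologicalSpace A] (β : ℤ → A) : Set (ℤ → A) :=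
  closure (Set.range fun (n : ℤ) (x : ℤ) => β (x + n))

/-! ### Discrete Schrödinger operators -/

/-- `ℓ²(ℤ)`. -/
abbrev EllTwo : Type := lp (fun _ : ℤ => ℂ) 2

theorem memlp_comp_equiv (f : EllTwo) (e : ℤ ≃ ℤ) : Memℓp (fun x => f (e x)) 2 := by
  have h := lp.memℓp f
  rw [memℓp_gen_iff (by norm_num)] at h ⊢
  exact (e.summable_iff (f := fun x => ‖f x‖ ^ (2 : ℝ≥0∞).toReal)).2 h

theorem memlp_potential_mul {A : Finset ℝ} (ω : ℤ → A) (f : EllTwo) :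
    Memℓp (fun x => (((ω x : ℝ) : ℂ) * f x : ℂ)) 2 := by
  have h := lp.memℓp f
  rw [memℓp_gen_iff (by norm_num)] at h ⊢
  refine Summable.of_nonneg_of_le (fun _ => by positivity) (fun x => ?_)
    (h.mul_left ((∑ a ∈ A, |a|) ^ (2 : ℝ≥0∞).toReal))
  rw [norm_mul, Real.mul_rpow (norm_nonneg _) (norm_nonneg _), Complex.norm_real]
  have : ‖(ω x : ℝ)‖ ≤ ∑ a ∈ A, |a| :=
    Finset.single_le_sum (f := fun a : ℝ => |a|) (fun _ _ => abs_nonneg _) (ω x).2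
  gcongr

theorem memlp_schrodinger {A : Finset ℝ} (ω : ℤ → A) (f : EllTwo) :
    Memℓp (fun x => (f (x + 1) + f (x - 1) + ((ω x : ℝ) : ℂ) * f x : ℂ)) 2 :=
  ((memlp_comp_equiv f (Equiv.addRight 1)).add (memlp_comp_equiv f (Equiv.subRight 1))).add
    (memlp_potential_mul ω f)

/-- The discrete Schrödinger operator on `ℓ²(ℤ)` with potential `ω` taking values in the finite
set `A` of real numbers: `(H ψ)(n) = ψ(n+1) + ψ(n-1) + ω(n) ψ(n)`. -/
noncomputable def schrodinger {A : Finset ℝ} (ω : ℤ → A) : EllTwo →ₗ[ℂ] EllTwo where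
  toFun f := ⟨fun x => f (x + 1) + f (x - 1) + ((ω x : ℝ) : ℂ) * f x, memlp_schrodinger ω f⟩
  map_add' f g := by
    ext x
    simp only [lp.coeFn_add, Pi.add_apply]
    ring
  map_smul' r f := by
    ext x
    simp only [lp.coeFn_smul, Pi.smul_apply, smul_eq_mul, RingHom.id_apply]
    ring

/-- The point spectrum: the set of eigenvalues. -/
def pointSpectrum {E : Type*} [AddCommGroup E] [Module ℂ E] (H : E →ₗ[ℂ] E) : Set ℂ :=
  {z | Module.End.HasEigenvalue H z}

/-! ### Hole structures of two-sided sequences -/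

/-! The complexity bound forces a rigid hole structure, and a potential with that structure admits
no nonzero square-summable solution.

Combinatorics. When the holes of `β` refine from modulus `p` to `n p`, the window `0, p, …, (n-1) p`
shows a constant word and `2 n` words recording the place of a hole and one of two contents. Only `2
n` words are allowed, so two of these coincide; then the filling between the new holes is constant,
or it has a smaller period and induction applies. Hence every refinement splits into steps that fill
with a single letter (`reflTransGen_constantStep`), and `β` has an infinite tower of such steps
(`IsToeplitzWord.exists_constantTower`). Recurrence makes both letters fill infinitely many levels,
and the tower passes to each `ω` in the hull with the same periods and letters.

Analysis. Eigenvalues are real, so real solutions `ψ` suffice. Let `t k` be the trace of the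
transfer matrix over one period of level `k`, with holes filled by `z k`. Wherever the potential
agrees with that filling strictly between `q - p k` and `q + p k`, `ψ (q + p k) + ψ (q - p k) = t k
* ψ q`. At a hole where `|ψ|` is maximal this yields `|t k| ≤ 2` for infinitely many `k`. Now fix
`q` with `ψ q ≠ 0`. A Gordon-type argument and the decay of `ψ` trap `q` between two neighbouring
holes of equal letter. The trap persists at all later levels, with `|t k| ≤ 1/5` and `p (k + 1) = 3
* p k` (`isEnclosed_step`). The sum of squares of `ψ` at the two enclosing holes then retains at
least the fraction `16/25` per level, while the Wronskian of `ψ` and its translate by `p k`,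
constant along a block, bounds it by a constant over `p k`. Since `3 * 16/25 > 1`, this is
impossible (`solution_eq_zero`). -/

/-- `V` has period `p` outside the residue class of `h` modulo `p`. -/
def PeriodicOffClass {A : Type*} (V : ℤ → A) (p : ℕ) (h : ℤ) : Prop :=
  ∀ x : ℤ, ¬ (p : ℤ) ∣ x - h → V (x + p) = V x

/-- `V` equals the letter `z` on the class `s` (modulus and representative), except possibly on the
subclass `t`, whose modulus is a proper multiple. -/
structure IsConstantStep {A : Type*} (V : ℤ → A) (s t : ℕ × ℤ) (z : A) : Prop where
  modulus : ∃ n, 2 ≤ n ∧ t.1 = n * s.1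
  dvd_sub : (s.1 : ℤ) ∣ t.2 - s.2
  letter : ∀ x : ℤ, (s.1 : ℤ) ∣ x - s.2 → ¬ (t.1 : ℤ) ∣ x - t.2 → V x = z

theorem IsConstantStep.congr_left {A : Type*} {V : ℤ → A} {p : ℕ} {h h' : ℤ} {t : ℕ × ℤ} {z : A}
    (hs : IsConstantStep V (p, h) t z) (hh : (p : ℤ) ∣ h - h') : IsConstantStep V (p, h') t z where
  modulus := hs.modulus
  dvd_sub := by
    have := dvd_add hs.dvd_sub hh
    simpa using this
  letter x hx := by
    refine hs.letter x ?_
    have := _root_.dvd_sub hx hh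
    simpa using this

theorem PeriodicOffClass.add_mul {A : Type*} {V : ℤ → A} {p : ℕ} {h : ℤ}
    (hV : PeriodicOffClass V p h) {x : ℤ} (hx : ¬ (p : ℤ) ∣ x - h) (k : ℤ) :
    V (x + p * k) = V x := by
  have key : ∀ k : ℤ, V (x + p * (k + 1)) = V (x + p * k) := by
    intro k
    have : ¬ (p : ℤ) ∣ x + p * k - h := by
      intro hd
      apply hx
      have e : x - h = (x + p * k - h) - p * k := by ring
      rw [e]
      exact dvd_sub hd (dvd_mul_right (p : ℤ) k)
    have := hV _ this
    rw [← this]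
    congr 1
    ring
  induction k using Int.induction_on with
  | zero => simp
  | succ k ih => rw [key, ih]
  | pred k ih =>
    rw [← ih, ← key]
    congr 1
    ring

theorem PeriodicOffClass.of_step {A : Type*} {V : ℤ → A} {s t : ℕ × ℤ} {z : A}
    (hV : PeriodicOffClass V s.1 s.2) (hs : IsConstantStep V s t z) :
    PeriodicOffClass V t.1 t.2 := by
  intro x hx
  obtain ⟨n, -, hn⟩ := hs.modulus
  by_cases hxs : (s.1 : ℤ) ∣ x - s.2
  · rw [hs.letter x hxs hx]
    apply hs.letter
    · rw [hn]
      push_cast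
      have e : x + n * (s.1 : ℤ) - s.2 = (x - s.2) + n * s.1 := by ring
      rw [e]
      exact dvd_add hxs (dvd_mul_left (s.1 : ℤ) n)
    · intro hd
      apply hx
      have e : x - t.2 = (x + t.1 - t.2) - t.1 := by ring
      rw [e]
      exact dvd_sub hd (dvd_refl (t.1 : ℤ))
  · have := hV.add_mul hxs n
    rw [← this, hn]
    push_cast
    congr 1
    ring

/-! ### Counting words: refinements split into constant steps -/

/-- The number of words seen through the window `0, p, …, (n-1) p`. -/
theorem encard_patternWords_le {A : Type*} (V : ℤ → A) {n p : ℕ} (hp : 0 < p) :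
    (patternWords V (fun j : Fin n => p * (j : ℕ))).encard ≤ maxPatternComplexity V n := by
  unfold maxPatternComplexity
  refine le_iSup_of_le (ι := {τ : Fin n → ℕ // StrictMono τ ∧ ∀ h : 0 < n, τ ⟨0, h⟩ = 0})
    ⟨fun j : Fin n => p * (j : ℕ), ?_, ?_⟩ le_rfl
  · intro i j hij
    exact Nat.mul_lt_mul_of_pos_left hij hp
  · intro h
    simp

theorem Function.Periodic.int_gcd {A : Type*} {F : ℤ → A} {m n : ℤ} (hm : Function.Periodic F m)
    (hn : Function.Periodic F n) : Function.Periodic F (Int.gcd m n : ℤ) := by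
  rw [Int.gcd_eq_gcd_ab, mul_comm m, mul_comm n]
  exact (hm.int_mul _).add_period (hn.int_mul _)

/-- If filling the hole of an `n`-periodic word with `e`, or with `e'`, gives two sequences that
are translates of each other, then `e = e'`. -/
theorem filling_eq_of_translate {A : Type*} {f : ℤ → A} {n : ℕ} {d : ℤ} {e e' : A} (hn : 0 < n)
    (h : ∀ i : ℤ, (if (n : ℤ) ∣ i then e else f i) = if (n : ℤ) ∣ i - d then e' else f (i - d)) :
    e = e' := by
  -- Walk along `0, d, 2d, …` up to the first return to the hole class: the value `e'` at `0` is
  -- carried through non-holes, where both fillings agree, and arrives at a hole carrying `e`.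
  have hex : ∃ k : ℕ, 0 < k ∧ (n : ℤ) ∣ k * d := ⟨n, hn, dvd_mul_right _ _⟩
  classical
  set k := Nat.find hex with hk
  obtain ⟨hk0, hkd⟩ : 0 < k ∧ (n : ℤ) ∣ k * d := Nat.find_spec hex
  have hmin : ∀ i : ℕ, 0 < i → i < k → ¬ (n : ℤ) ∣ i * d := fun i hi hik hdi =>
    Nat.find_min hex hik ⟨hi, hdi⟩
  have key : ∀ i : ℕ, i + 1 ≤ k →
      (if (n : ℤ) ∣ ((i + 1 : ℕ) : ℤ) * d then e else f (((i + 1 : ℕ) : ℤ) * d)) = e' := by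
    intro i
    induction i with
    | zero =>
      intro _
      rw [h]
      simp
    | succ i ih =>
      intro hi
      have h1 := ih (by omega)
      rw [if_neg (hmin (i + 1) (by omega) (by omega))] at h1
      rw [h]
      have h2 : ((i + 1 + 1 : ℕ) : ℤ) * d - d = ((i + 1 : ℕ) : ℤ) * d := by
        push_cast
        ring
      rw [h2, if_neg (hmin (i + 1) (by omega) (by omega)), h1]
  have h3 := key (k - 1) (by omega)
  rw [Nat.sub_add_cancel hk0, if_pos hkd] at h3
  exact h3

/-- A sequence of low maximal pattern complexity whose hole structure refines from modulus `p` to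
modulus `n p`, and which is constant on some class modulo `p`, refines through constant steps. -/
theorem reflTransGen_constantStep {A : Type*} {V : ℤ → A}
    (hc : ∀ n : ℕ, 1 ≤ n → maxPatternComplexity V n ≤ ((2 * n : ℕ) : ℕ∞)) {p : ℕ} {h x₀ : ℤ}
    (hp : 0 < p) (hV : PeriodicOffClass V p h) (hx₀ : ∀ j : ℤ, V (x₀ + p * j) = V x₀) (n : ℕ)
    (hn : 1 ≤ n) (hVn : PeriodicOffClass V (n * p) h)
    (hfill : ∃ s t : ℤ, V (h + (n * p : ℕ) * s) ≠ V (h + (n * p : ℕ) * t)) :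
    Relation.ReflTransGen (fun s t => ∃ z, IsConstantStep V s t z) (p, h) (n * p, h) := by
  induction n using Nat.strong_induction_on with
  | _ n ih =>
  rcases Nat.lt_or_ge n 2 with hn2 | hn2
  · obtain rfl : n = 1 := by omega
    rw [one_mul]
  have hn0 : (0 : ℤ) < n := by omega
  have hp0 : (0 : ℤ) < p := by omega
  set f : ℤ → A := fun j => V (h + p * j) with hf
  have hfper : ∀ i : ℤ, ¬ (n : ℤ) ∣ i → ∀ k : ℤ, f (i + n * k) = f i := by
    intro i hi k
    have h1 : ¬ ((n * p : ℕ) : ℤ) ∣ (h + p * i) - h := by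
      intro hd
      apply hi
      have h2 : (p : ℤ) * n ∣ p * i := by
        convert hd using 1 <;> push_cast <;> ring
      exact Int.dvd_of_mul_dvd_mul_left hp0.ne' h2
    have h2 := hVn.add_mul h1 k
    simp only [hf]
    rw [← h2]
    congr 1
    push_cast
    ring
  obtain ⟨s, t, hst⟩ := hfill
  set u : Bool → ℤ := fun b => if b then s else t with hu
  set e : Bool → A := fun b => f (n * u b) with he
  have hne : ∀ b b', e b = e b' → b = b' := by
    have h1 : f (n * s) ≠ f (n * t) := by
      simp only [hf]
      convert hst using 2 <;> push_cast <;> ring_nf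
    intro b b'
    cases b <;> cases b' <;> simp only [he, hu] <;> simp [h1, h1.symm]
  -- the sequence of period `n` obtained by filling all holes with `e b`
  set F : Bool → ℤ → A := fun b i => if (n : ℤ) ∣ i then e b else f i with hF
  have hFper : ∀ b, Function.Periodic (F b) (n : ℤ) := by
    intro b i
    simp only [hF]
    by_cases hi : (n : ℤ) ∣ i
    · rw [if_pos hi, if_pos (by simpa using hi)]
    · rw [if_neg hi, if_neg (by simpa using hi)]
      simpa using hfper i hi 1
  have hFsub : ∀ b i (k : ℤ), F b (i - k * n) = F b i := fun b i k => by
    simpa using (hFper b).sub_int_mul_eq k (x := i)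
  -- These are `2 n + 1` words: the constant one seen from `x₀`, and those whose position `r` is a
  -- hole of modulus `n p` with content `e b`. A window of length `n` meets exactly one such hole.
  set w : Option (Fin n × Bool) → Fin n → A := fun o =>
    match o with
    | none => fun _ => V x₀
    | some (r, b) => fun j => f (n * u b - (r : ℕ) + (j : ℕ)) with hw
  have hwF : ∀ (r : Fin n) (b : Bool) (j : Fin n), w (some (r, b)) j = F b ((j : ℕ) - (r : ℕ)) := by
    intro r b j
    simp only [hw, hF]
    by_cases hd : (n : ℤ) ∣ ((j : ℕ) : ℤ) - ((r : ℕ) : ℤ)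
    · have : ((j : ℕ) : ℤ) - ((r : ℕ) : ℤ) = 0 :=
        Int.eq_zero_of_abs_lt_dvd hd (by rw [abs_lt]; omega)
      rw [if_pos hd]
      simp only [he]
      congr 1
      linarith
    · rw [if_neg hd, ← hfper _ hd (u b)]
      congr 1
      ring
  have hrange : ∀ o, w o ∈ patternWords V (fun j : Fin n => p * (j : ℕ)) := by
    rintro (_ | ⟨r, b⟩)
    · refine ⟨x₀, ?_⟩
      funext j
      have := hx₀ ((j : ℕ) : ℤ)
      simp only [hw]
      push_cast
      exact this
    · refine ⟨h + p * (n * u b - (r : ℕ)), ?_⟩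
      funext j
      simp only [hw, hf]
      push_cast
      congr 1
      ring
  have hninj : ¬ Function.Injective w := by
    intro hinj
    have h1 : (Set.range w).encard ≤ ((2 * n : ℕ) : ℕ∞) :=
      (Set.encard_le_encard (Set.range_subset_iff.2 hrange)).trans
        ((encard_patternWords_le V hp).trans (hc n hn))
    rw [← Set.image_univ, hinj.encard_image, Set.encard_univ, ENat.card_eq_coe_fintype_card] at h1
    simp only [Fintype.card_option, Fintype.card_prod, Fintype.card_fin, Fintype.card_bool] at h1
    have h2 : n * 2 + 1 ≤ 2 * n := by exact_mod_cast h1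
    omega
  -- a constant hole-free word gives a single step
  have hconst : (∃ z, ∀ i : ℤ, ¬ (n : ℤ) ∣ i → f i = z) →
      Relation.ReflTransGen (fun s t => ∃ z, IsConstantStep V s t z) (p, h) (n * p, h) := by
    rintro ⟨z, hz⟩
    refine Relation.ReflTransGen.single ⟨z, ⟨n, hn2, rfl⟩, by simp, ?_⟩
    intro x hx hx'
    obtain ⟨i, hi⟩ := hx
    have hxi : x = h + p * i := by
      simp only at hi
      linarith
    rw [hxi]
    refine hz i fun hd => hx' ?_
    simp only
    rw [hi]
    push_cast
    rw [mul_comm (n : ℤ)]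
    exact mul_dvd_mul_left _ hd
  have hmod : ∀ i : ℤ, ∃ j : Fin n, (n : ℤ) ∣ i - (j : ℕ) := by
    intro i
    have h1 := Int.emod_nonneg i hn0.ne'
    have h2 := Int.emod_lt_of_pos i hn0
    refine ⟨⟨(i % n).toNat, by omega⟩, ?_⟩
    simp only
    rw [Int.toNat_of_nonneg h1]
    exact Int.dvd_self_sub_emod
  have hcase1 : ∀ (r : Fin n) (b : Bool), w (some (r, b)) = w none →
      ∃ z, ∀ i : ℤ, ¬ (n : ℤ) ∣ i → f i = z := by
    intro r b hrb
    refine ⟨V x₀, fun i hi => ?_⟩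
    obtain ⟨j, k, hk⟩ := hmod (i + (r : ℕ))
    have h1 := congrFun hrb j
    rw [hwF] at h1
    have h2 : ((j : ℕ) : ℤ) - (r : ℕ) = i - k * n := by linarith
    rw [h2, hFsub] at h1
    simp only [hF, if_neg hi] at h1
    exact h1
  simp only [Function.Injective, not_forall] at hninj
  obtain ⟨o, o', hoo, hne'⟩ := hninj
  match o, o', hoo, hne' with
  | none, none, _, h1 => exact absurd rfl h1
  | some (r, b), none, h1, _ => exact hconst (hcase1 r b h1)
  | none, some (r, b), h1, _ => exact hconst (hcase1 r b h1.symm)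
  | some (r, b), some (r', b'), hww, hrr =>
  set d : ℤ := (r' : ℕ) - (r : ℕ) with hd
  have hFF : ∀ i : ℤ, F b i = F b' (i - d) := by
    intro i
    obtain ⟨j, k, hk⟩ := hmod (i + (r : ℕ))
    have h1 := congrFun hww j
    rw [hwF, hwF] at h1
    have h2 : ((j : ℕ) : ℤ) - (r : ℕ) = i - k * n := by linarith
    have h3 : ((j : ℕ) : ℤ) - (r' : ℕ) = i - d - k * n := by linarith
    rw [h2, h3, hFsub, hFsub] at h1
    exact h1
  -- Two coinciding words make `F b` a translate of `F b'` by `d`. A trivial translation would give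
  -- `(r, b) = (r', b')`; a nontrivial one forces `b = b'`, hence the new period `d`.
  have hnd : ¬ (n : ℤ) ∣ d := by
    intro hdd
    have hd0 : d = 0 := Int.eq_zero_of_abs_lt_dvd hdd (by rw [abs_lt]; omega)
    apply hrr
    have h1 : r = r' := by
      apply Fin.ext
      omega
    have h2 := hFF 0
    simp only [hF, hd0, sub_zero, dvd_zero, if_true] at h2
    rw [h1, hne _ _ h2]
  have hbb : b = b' := hne _ _ (filling_eq_of_translate (by omega) hFF)
  subst hbb
  have hFd : Function.Periodic (F b) d := by
    intro i
    rw [hFF (i + d)]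
    congr 1
    ring
  set g : ℕ := Int.gcd d n with hg
  have hFg : Function.Periodic (F b) (g : ℤ) := hFd.int_gcd (hFper b)
  have hgn : (g : ℤ) ∣ n := Int.gcd_dvd_right _ _
  have hgd : (g : ℤ) ∣ d := Int.gcd_dvd_left _ _
  have hgn' : g ∣ n := by exact_mod_cast hgn
  have hgne : g ≠ n := by
    intro hgn2
    rw [hgn2] at hgd
    exact hnd hgd
  have hgpos : 0 < g := Nat.pos_of_dvd_of_pos hgn' (by omega)
  obtain ⟨m, hm⟩ := hgn'
  have hm2 : 2 ≤ m := by
    rcases m with _ | _ | m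
    · omega
    · omega
    · omega
  have hglt : g < n := by nlinarith
  have hVg : PeriodicOffClass V (g * p) h := by
    intro x hx
    by_cases hxp : (p : ℤ) ∣ x - h
    · obtain ⟨i, hi⟩ := hxp
      have hxi : x = h + p * i := by linarith
      have hgi : ¬ (g : ℤ) ∣ i := by
        intro hd
        apply hx
        rw [hi]
        push_cast
        rw [mul_comm (g : ℤ)]
        exact mul_dvd_mul_left _ hd
      have hni : ¬ (n : ℤ) ∣ i := fun hd => hgi (hgn.trans hd)
      have hni' : ¬ (n : ℤ) ∣ i + g := fun hd => hgi (by simpa using hgn.trans hd)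
      have h1 := hFg i
      simp only [hF, if_neg hni, if_neg hni'] at h1
      simp only [hf] at h1
      rw [hxi, ← h1]
      congr 1
      push_cast
      ring
    · have := hV.add_mul hxp g
      rw [← this]
      congr 1
      push_cast
      ring
  -- Induction reaches modulus `g p`. The last step is constant because `F b` has period `g`, so it
  -- equals `e b` at all multiples of `g`. The factor `m = n / g` re-expresses the two differing
  -- sites at modulus `g p`.
  refine (ih g hglt hgpos hVg ⟨m * s, m * t, ?_⟩).tail ⟨e b, ⟨m, hm2, ?_⟩, by simp, ?_⟩
  · convert hst using 2 <;> (rw [hm]; push_cast; ring_nf)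
  · simp only
    rw [hm]
    ring
  · intro x hx hx'
    obtain ⟨k, hk⟩ := hx
    have hxi : x = h + p * (g * k) := by
      simp only at hk
      push_cast at hk
      linarith
    have hngk : ¬ (n : ℤ) ∣ g * k := by
      intro hd
      apply hx'
      simp only
      have : x - h = p * (g * k) := by linarith
      rw [this]
      push_cast
      rw [mul_comm (n : ℤ)]
      exact mul_dvd_mul_left _ hd
    have h1 : F b (g * k) = F b 0 := by
      have := hFg.int_mul k 0
      rw [← this, Int.cast_id]
      congr 1
      ring
    simp only [hF, if_neg hngk, dvd_zero, if_true] at h1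
    rw [hxi]
    exact h1

/-! ### Constant towers -/

/-- An infinite hierarchy of hole classes `h k + p k ℤ` of `V`, each step of which removes all but
one subclass of holes and fills the removed ones with the single letter `z k`. -/
structure IsConstantTower {A : Type*} (V : ℤ → A) (p : ℕ → ℕ) (h : ℕ → ℤ) (z : ℕ → A) : Prop where
  pos_zero : 0 < p 0
  periodic_zero : PeriodicOffClass V (p 0) (h 0)
  step : ∀ k, IsConstantStep V (p k, h k) (p (k + 1), h (k + 1)) (z k)

namespace IsConstantTower

variable {A : Type*} {V : ℤ → A} {p : ℕ → ℕ} {h : ℕ → ℤ} {z : ℕ → A}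

theorem periodic (T : IsConstantTower V p h z) (k : ℕ) : PeriodicOffClass V (p k) (h k) := by
  induction k with
  | zero => exact T.periodic_zero
  | succ k ih =>
    exact PeriodicOffClass.of_step (s := (p k, h k)) (t := (p (k + 1), h (k + 1))) ih (T.step k)

theorem exists_mul (T : IsConstantTower V p h z) (k : ℕ) : ∃ n, 2 ≤ n ∧ p (k + 1) = n * p k :=
  (T.step k).modulus

theorem two_pow_le (T : IsConstantTower V p h z) (k : ℕ) : 2 ^ k ≤ p k := by
  induction k with
  | zero => simpa using Nat.succ_le_of_lt T.pos_zero
  | succ k ih =>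
    obtain ⟨n, hn, hp⟩ := T.exists_mul k
    rw [hp, pow_succ, mul_comm]
    exact Nat.mul_le_mul hn ih

theorem pos (T : IsConstantTower V p h z) (k : ℕ) : 0 < p k :=
  lt_of_lt_of_le (by positivity) (T.two_pow_le k)

theorem dvd_succ (T : IsConstantTower V p h z) (k : ℕ) : (p k : ℤ) ∣ p (k + 1) := by
  obtain ⟨n, -, hp⟩ := T.exists_mul k
  rw [hp]
  push_cast
  exact dvd_mul_left _ _

theorem hole_of_hole_succ (T : IsConstantTower V p h z) {k : ℕ} {x : ℤ}
    (hx : (p (k + 1) : ℤ) ∣ x - h (k + 1)) : (p k : ℤ) ∣ x - h k := by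
  have h1 : (p k : ℤ) ∣ h (k + 1) - h k := (T.step k).dvd_sub
  have := dvd_add ((T.dvd_succ k).trans hx) h1
  simpa using this

theorem hole_of_le (T : IsConstantTower V p h z) {k m : ℕ} (hkm : k ≤ m) {x : ℤ}
    (hx : (p m : ℤ) ∣ x - h m) : (p k : ℤ) ∣ x - h k := by
  induction m, hkm using Nat.le_induction with
  | base => exact hx
  | succ m _ ih => exact ih (T.hole_of_hole_succ hx)

theorem letter (T : IsConstantTower V p h z) {k : ℕ} {x : ℤ} (hx : (p k : ℤ) ∣ x - h k)
    (hx' : ¬ (p (k + 1) : ℤ) ∣ x - h (k + 1)) : V x = z k :=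
  (T.step k).letter x hx hx'

end IsConstantTower

/-- The filling of a hole class of an aperiodic sequence is not constant. -/
theorem PeriodicOffClass.exists_ne {A : Type*} {V : ℤ → A} {p : ℕ} {h : ℤ}
    (hV : PeriodicOffClass V p h) (hp : 0 < p) (ha : IsAperiodic V) :
    ∃ s t : ℤ, V (h + p * s) ≠ V (h + p * t) := by
  by_contra! hcon
  obtain ⟨i, hi⟩ := ha p (by omega)
  apply hi
  by_cases hd : (p : ℤ) ∣ i - h
  · obtain ⟨k, hk⟩ := hd
    have h1 : i = h + p * k := by linarith
    have := hcon (k + 1) k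
    rw [h1, ← this]
    congr 1
    ring
  · exact hV i hd

/-! ### Periods and holes of a Toeplitz coding -/

namespace ToeplitzCoding

variable {A : Type*} (c : ToeplitzCoding A)

theorem totalPeriod_succ (m : ℕ) : c.totalPeriod (m + 1) = c.period m * c.totalPeriod m := by
  rw [totalPeriod, Finset.prod_range_succ, mul_comm]
  rfl

theorem totalOffset_succ (m : ℕ) :
    c.totalOffset (m + 1) = c.totalOffset m + c.totalPeriod m * c.offset m := by
  rw [totalOffset, Finset.sum_range_succ]
  rfl

theorem two_le_period (m : ℕ) : 2 ≤ c.period m := by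
  have := List.length_pos_iff.2 (c.word_ne_nil m)
  unfold period
  omega

theorem totalPeriod_pos (m : ℕ) : 0 < c.totalPeriod m :=
  Finset.prod_pos fun i _ => lt_of_lt_of_le two_pos (c.two_le_period i)

theorem hole_of_hole_succ {m : ℕ} {x : ℤ}
    (hx : (c.totalPeriod (m + 1) : ℤ) ∣ x - c.totalOffset (m + 1)) :
    (c.totalPeriod m : ℤ) ∣ x - c.totalOffset m := by
  have h1 : (c.totalPeriod m : ℤ) ∣ c.totalPeriod (m + 1) := by
    rw [totalPeriod_succ]
    push_cast
    exact dvd_mul_left _ _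
  have h2 := dvd_add (h1.trans hx) (dvd_mul_right (c.totalPeriod m : ℤ) (c.offset m))
  have h3 : x - c.totalOffset m
      = x - c.totalOffset (m + 1) + (c.totalPeriod m : ℤ) * c.offset m := by
    rw [totalOffset_succ]
    push_cast
    ring
  rw [h3]
  exact h2

theorem partialWord_eq_of_le {m M : ℕ} (hmM : m ≤ M) {x : ℤ}
    (hx : ¬ (c.totalPeriod m : ℤ) ∣ x - c.totalOffset m) :
    c.partialWord M x = c.partialWord m x := by
  have hM : c.partialWord M x = c.partialWord m x ∧
      ¬ (c.totalPeriod M : ℤ) ∣ x - c.totalOffset M := by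
    induction M, hmM using Nat.le_induction with
    | base => exact ⟨rfl, hx⟩
    | succ M _ ih =>
      refine ⟨?_, fun hd => ih.2 (c.hole_of_hole_succ hd)⟩
      rw [← ih.1, partialWord, composePartialWords, if_neg ih.2]
  exact hM.1

theorem partialWord_periodic (m : ℕ) :
    Function.Periodic (c.partialWord m) (c.totalPeriod m : ℤ) := by
  induction m with
  | zero => exact fun _ => rfl
  | succ m ih =>
    intro x
    have hp : (c.totalPeriod m : ℤ) ≠ 0 := by exact_mod_cast (c.totalPeriod_pos m).ne'
    have h1 : x + (c.totalPeriod (m + 1) : ℤ) - c.totalOffset m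
        = x - c.totalOffset m + c.totalPeriod m * c.period m := by
      rw [totalPeriod_succ]
      push_cast
      ring
    simp only [partialWord, composePartialWords]
    simp only [h1, dvd_add_left (dvd_mul_right _ _)]
    split_ifs with hd
    · rw [Int.add_mul_ediv_left _ _ hp]
      simp only [periodicPartialWord]
      congr 2
      have h2 : (c.period m : ℤ) = (c.word m).length + 1 := by simp [period]
      rw [h2]
      set q := (x - (c.totalOffset m : ℤ)) / (c.totalPeriod m : ℤ)
      have h3 : q + (((c.word m).length : ℤ) + 1) - c.offset m - 1
        = q - c.offset m - 1 + (((c.word m).length : ℤ) + 1) := by ring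
      rw [h3, Int.add_emod_right]
    · rw [totalPeriod_succ]
      push_cast
      simpa using ih.int_mul (c.period m : ℤ) x

theorem periodicOffClass {β : ℤ → A} {a : A} (hβ : ∀ m x,
    ¬ (c.totalPeriod m : ℤ) ∣ x - c.totalOffset m → β x = (c.partialWord m x).getD a) (m : ℕ) :
    PeriodicOffClass β (c.totalPeriod m) (c.totalOffset m) := by
  intro x hx
  have hx' : ¬ (c.totalPeriod m : ℤ) ∣ x + c.totalPeriod m - c.totalOffset m := by
    intro hd
    apply hx
    have e : x - (c.totalOffset m : ℤ)
      = (x + c.totalPeriod m - c.totalOffset m) - c.totalPeriod m := by ring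
    rw [e]
    exact dvd_sub hd dvd_rfl
  rw [hβ m x hx, hβ m _ hx', c.partialWord_periodic m x]

end ToeplitzCoding

/-! ### From Toeplitz words to constant towers -/

theorem IsToeplitzWord.exists_coding {A : Type*} {β : ℤ → A} (hT : IsToeplitzWord β) :
    ∃ (c : ToeplitzCoding A) (a : A), ∀ m x,
      ¬ (c.totalPeriod m : ℤ) ∣ x - c.totalOffset m → β x = (c.partialWord m x).getD a := by
  obtain ⟨c, hc⟩ := hT
  obtain ⟨a, α, hα, hβ⟩ : ∃ (a : A) (α : ℤ → Option A), c.IsLimitWord α ∧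
      ∀ x, β x = (α x).getD a := by
    rcases hc with ⟨-, hα, -⟩ | ⟨-, a, -, α, hα, hβ, -⟩
    -- In the normal case no hole remains, so `β 0` is only a dummy default.
    · exact ⟨β 0, _, hα, fun x => rfl⟩
    · exact ⟨a, α, hα, hβ⟩
  refine ⟨c, a, fun m x hx => ?_⟩
  obtain ⟨M, hM, hmM⟩ := ((hα x).and (eventually_ge_atTop m)).exists
  rw [hβ, ← hM, c.partialWord_eq_of_le hmM hx]

/-- A Toeplitz word with maximal pattern complexity at most `2 n` has, after finitely many steps
of its coding, a hole structure all of whose steps are constant. -/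
theorem IsToeplitzWord.exists_constantTower {A : Type*} {β : ℤ → A} (hT : IsToeplitzWord β)
    (ha : IsAperiodic β)
    (hc : ∀ n : ℕ, 1 ≤ n → maxPatternComplexity β n ≤ ((2 * n : ℕ) : ℕ∞)) :
    ∃ p h z, IsConstantTower β p h z := by
  obtain ⟨c, a, hβ⟩ := hT.exists_coding
  set R : ℕ × ℤ → ℕ × ℤ → Prop := fun s t => ∃ z, IsConstantStep β s t z with hR
  set P : ℕ → ℕ × ℤ := fun m => (c.totalPeriod m, c.totalOffset m) with hP
  have hlev : ∀ m, PeriodicOffClass β (c.totalPeriod m) (c.totalOffset m) :=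
    c.periodicOffClass hβ
  have hchain : ∀ m, 1 ≤ m → ∃ y, R (P m) y ∧ Relation.ReflTransGen R y (P (m + 1)) := by
    intro m hm
    have hcong : (c.totalPeriod m : ℤ) ∣ (c.totalOffset (m + 1) : ℤ) - c.totalOffset m := by
      rw [c.totalOffset_succ]
      push_cast
      simp
    have hlev' : PeriodicOffClass β (c.totalPeriod m) (c.totalOffset (m + 1)) := by
      intro x hx
      refine hlev m x fun hd => hx ?_
      have := dvd_sub hd hcong
      simpa using this
    -- The site after a hole of level `1` is already filled there, so its letter repeats with every
    -- later period. This is why the tower starts at level `1`.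
    have hx₀ : ∀ j : ℤ, β ((c.totalOffset 1 + 1 : ℤ) + c.totalPeriod m * j)
        = β (c.totalOffset 1 + 1 : ℤ) := by
      intro j
      have h1 : c.totalPeriod 1 ∣ c.totalPeriod m := by
        unfold ToeplitzCoding.totalPeriod
        exact Finset.prod_dvd_prod_of_subset _ _ _ (Finset.range_mono hm)
      obtain ⟨d, hd⟩ := h1
      have h2 : ¬ (c.totalPeriod 1 : ℤ) ∣ (c.totalOffset 1 + 1 : ℤ) - c.totalOffset 1 := by
        have h3 : 2 ≤ c.totalPeriod 1 := by
          have := c.two_le_period 0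
          simpa [ToeplitzCoding.totalPeriod] using this
        intro hdv
        have h4 : (c.totalPeriod 1 : ℤ) ∣ 1 := by simpa using hdv
        have := Int.le_of_dvd one_pos h4
        omega
      rw [← (hlev 1).add_mul h2 (d * j), hd]
      congr 1
      push_cast
      ring
    have hn := c.two_le_period m
    have hmain := reflTransGen_constantStep hc (c.totalPeriod_pos m) hlev' hx₀ (c.period m)
      (by omega) (by rw [← c.totalPeriod_succ]; exact hlev (m + 1))
      (by rw [← c.totalPeriod_succ]
          exact (hlev (m + 1)).exists_ne (c.totalPeriod_pos _) ha)
    rw [← c.totalPeriod_succ] at hmain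
    rcases hmain.cases_head with heq | ⟨y, ⟨z, hz⟩, hy⟩
    · exfalso
      have h1 := congrArg Prod.fst heq
      simp only [c.totalPeriod_succ] at h1
      have := c.totalPeriod_pos m
      nlinarith
    · exact ⟨y, ⟨z, hz.congr_left hcong⟩, hy⟩
  -- The finite chains between coding levels are glued by iterating a successor map on all vertices
  -- from which some coding level can be reached.
  set S : Type := {s : ℕ × ℤ // ∃ m, 1 ≤ m ∧ Relation.ReflTransGen R s (P m)} with hS
  have hsucc : ∀ s : S, ∃ t : S, R s.1 t.1 := by
    rintro ⟨s, m, hm, hs⟩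
    rcases hs.cases_head with rfl | ⟨y, hy, hy'⟩
    · obtain ⟨y, hy, hy'⟩ := hchain m hm
      exact ⟨⟨y, m + 1, by omega, hy'⟩, hy⟩
    · exact ⟨⟨y, m, hm, hy'⟩, hy⟩
  choose f hf using hsucc
  set g : ℕ → S := fun k => f^[k] ⟨P 1, 1, le_rfl, Relation.ReflTransGen.refl⟩ with hg
  have hgs : ∀ k, R (g k).1 (g (k + 1)).1 := by
    intro k
    simp only [hg, Function.iterate_succ_apply']
    exact hf _
  choose z hz using hgs
  exact ⟨fun k => (g k).1.1, fun k => (g k).1.2, z, c.totalPeriod_pos 1, hlev 1, hz⟩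

/-- In a recurrent aperiodic sequence with a constant tower, every letter that occurs is used in
infinitely many steps, provided that there are only two letters. -/
theorem IsConstantTower.exists_letter_eq {A : Type*} {V : ℤ → A} {p : ℕ → ℕ} {h : ℕ → ℤ}
    {z : ℕ → A} (T : IsConstantTower V p h z) (ha : IsAperiodic V) (hr : IsRecurrent V)
    (h2 : ∀ a b b' : A, b ≠ a → b' ≠ a → b = b') (a : A) (K : ℕ) : ∃ k, K ≤ k ∧ z k = a := by
  by_contra! hcon
  obtain ⟨b, hb⟩ : ∃ b : A, b ≠ a := ⟨z K, hcon K le_rfl⟩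
  have hzb : ∀ k, K ≤ k → z k = b := fun k hk => h2 a _ _ (hcon k hk) hb
  have hp := T.pos K
  -- If only `b` is used from level `K` on, a hole of that level with another letter is never
  -- removed. As the moduli tend to infinity, there is just one such site `q`.
  have hfill : ∀ x : ℤ, (p K : ℤ) ∣ x - h K → V x ≠ b → ∀ k, K ≤ k → (p k : ℤ) ∣ x - h k := by
    intro x hx hxb k hk
    induction k, hk using Nat.le_induction with
    | base => exact hx
    | succ k hk ih =>
      by_contra hd
      exact hxb ((T.letter ih hd).trans (hzb k hk))
  obtain ⟨q, hq, hqb⟩ : ∃ q : ℤ, (p K : ℤ) ∣ q - h K ∧ V q ≠ b := by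
    by_contra! hall
    obtain ⟨s, t, hst⟩ := (T.periodic K).exists_ne hp ha
    exact hst ((hall _ (by simp)).trans (hall _ (by simp)).symm)
  have huniq : ∀ x : ℤ, (p K : ℤ) ∣ x - h K → x ≠ q → V x = b := by
    intro x hx hxq
    by_contra hxb
    obtain ⟨k, hk⟩ : ∃ k, (x - q).natAbs < 2 ^ k := ⟨_, Nat.lt_two_pow_self⟩
    have h3 : (x - q).natAbs < 2 ^ (max k K) :=
      hk.trans_le (Nat.pow_le_pow_right two_pos (le_max_left _ _))
    have h4 := T.two_pow_le (max k K)
    have h5 := dvd_sub (hfill x hx hxb _ (le_max_right k K)) (hfill q hq hqb _ (le_max_right k K))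
    have h6 : (p (max k K) : ℤ) ∣ x - q := by
      simpa using h5
    have h7 := Int.eq_zero_of_abs_lt_dvd h6 (by rw [Int.abs_eq_natAbs]; exact_mod_cast h3.trans_le h4)
    exact hxq (by linarith)
  -- `V` is `p K`-periodic away from the two translates that involve `q`
  have hper : ∀ x : ℤ, x ≠ q → x + p K ≠ q → V (x + p K) = V x := by
    intro x h3 h4
    by_cases hx : (p K : ℤ) ∣ x - h K
    · rw [huniq x hx h3, huniq _ _ h4]
      have e : x + (p K : ℤ) - h K = x - h K + p K := by ring
      rw [e]
      exact dvd_add hx dvd_rfl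
    · exact T.periodic K x hx
  have hinf := hr q (p K + 1)
  -- Recurrence supplies an occurrence of the word of length `p K + 1` at `q` that avoids both
  -- places where the period relation `V (m + p K) = V m` could involve `q`. There the word has
  -- equal ends, but at `q` its ends differ.
  obtain ⟨m, hm, hmne⟩ : ∃ m ∈ {m : ℤ | ∀ j : ℕ, j < p K + 1 → V (m + j) = V (q + j)},
      m ∉ ({q, q - p K} : Set ℤ) := by
    by_contra! hsub
    exact hinf ((Set.toFinite _).subset hsub)
  simp only [Set.mem_insert_iff, Set.mem_singleton_iff, not_or] at hmne
  have e1 : V m = V q := by simpa using hm 0 (by omega)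
  have e2 := hm (p K) (by omega)
  have e3 : V (q + p K) = b := by
    refine huniq _ ?_ (by omega)
    have e : q + (p K : ℤ) - h K = q - h K + p K := by ring
    rw [e]
    exact dvd_add hq dvd_rfl
  rw [hper m hmne.1 (by omega), e1, e3] at e2
  exact hqb e2

/-! ### Solutions of second order difference equations -/

/-- `ψ (x + 1) + ψ (x - 1) = v x ψ x` for all `x`. -/
def IsSolution (v ψ : ℤ → ℝ) : Prop := ∀ x, ψ (x + 1) + ψ (x - 1) = v x * ψ x

/-- The one-step transfer matrix. -/
def transferStep (t : ℝ) : Matrix (Fin 2) (Fin 2) ℝ := !![t, -1; 1, 0]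

/-- The transfer matrix over the sites `i, …, i + n - 1`. -/
def transferProd (w : ℤ → ℝ) (i : ℤ) : ℕ → Matrix (Fin 2) (Fin 2) ℝ
  | 0 => 1
  | n + 1 => transferStep (w (i + n)) * transferProd w i n

theorem det_transferProd (w : ℤ → ℝ) (i : ℤ) (n : ℕ) : (transferProd w i n).det = 1 := by
  induction n with
  | zero => simp [transferProd]
  | succ n ih => rw [transferProd, Matrix.det_mul, ih]; simp [transferStep, Matrix.det_fin_two]

theorem transferProd_succ_one (w : ℤ → ℝ) (i : ℤ) (n : ℕ) (j : Fin 2) :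
    transferProd w i (n + 1) 1 j = transferProd w i n 0 j := by
  simp [transferProd, transferStep, Matrix.mul_apply, Fin.sum_univ_two]

theorem transferProd_add (w : ℤ → ℝ) (i : ℤ) (m n : ℕ) :
    transferProd w i (m + n) = transferProd w (i + m) n * transferProd w i m := by
  induction n with
  | zero => simp [transferProd]
  | succ n ih =>
    rw [← add_assoc, transferProd, transferProd, ih, Matrix.mul_assoc]
    congr 3
    push_cast
    ring

theorem transferProd_add_int_mul {w : ℤ → ℝ} {p : ℤ} (hw : Function.Periodic w p) (i k : ℤ)
    (n : ℕ) : transferProd w (i + k * p) n = transferProd w i n := by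
  induction n with
  | zero => rfl
  | succ n ih =>
    rw [transferProd, transferProd, ih]
    have := hw.int_mul k (i + n)
    rw [Int.cast_id] at this
    rw [← this]
    congr 3
    ring

theorem transferProd_mul {w : ℤ → ℝ} {p : ℕ} (hw : Function.Periodic w (p : ℤ)) (i : ℤ) (n : ℕ) :
    transferProd w i (n * p) = transferProd w i p ^ n := by
  induction n with
  | zero => simp [transferProd]
  | succ n ih =>
    rw [Nat.succ_mul, transferProd_add, ih, pow_succ']
    congr 1
    push_cast
    exact transferProd_add_int_mul hw i n p

/-- Moving the starting site by one conjugates the transfer matrix over a period by the one-step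
matrix. -/
theorem trace_transferProd_succ {w : ℤ → ℝ} {p : ℕ} (hw : Function.Periodic w (p : ℤ)) (i : ℤ) :
    (transferProd w (i + 1) p).trace = (transferProd w i p).trace := by
  have h1 : transferProd w (i + 1) p * transferStep (w i)
      = transferStep (w i) * transferProd w i p := by
    have h2 := transferProd_add w i 1 p
    have h3 : transferProd w i 1 = transferStep (w i) := by simp [transferProd]
    rw [h3, add_comm 1 p, transferProd, hw i] at h2
    exact h2.symm
  have h4 : transferStep (w i) * !![0, 1; -1, w i] = 1 := by
    simp [transferStep, Matrix.one_fin_two]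
  have h5 : !![0, 1; -1, w i] * transferStep (w i) = 1 := by
    simp [transferStep, Matrix.one_fin_two]
  calc (transferProd w (i + 1) p).trace
      = (transferProd w (i + 1) p * (transferStep (w i) * !![0, 1; -1, w i])).trace := by
        rw [h4, mul_one]
    _ = (transferStep (w i) * (transferProd w i p * !![0, 1; -1, w i])).trace := by
        rw [← mul_assoc, h1, mul_assoc]
    _ = (transferProd w i p).trace := by
        rw [Matrix.trace_mul_comm, mul_assoc, h5, mul_one]

theorem trace_transferProd {w : ℤ → ℝ} {p : ℕ} (hw : Function.Periodic w (p : ℤ)) (i : ℤ) :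
    (transferProd w i p).trace = (transferProd w 0 p).trace := by
  induction i using Int.induction_on with
  | zero => rfl
  | succ k ih => rw [trace_transferProd_succ hw, ih]
  | pred k ih => rw [← ih, ← trace_transferProd_succ hw, sub_add_cancel]

theorem transferProd_mulVec {w ψ : ℤ → ℝ} {i : ℤ} {n : ℕ}
    (h : ∀ j, i ≤ j → j < i + n → ψ (j + 1) + ψ (j - 1) = w j * ψ j) :
    transferProd w i n 0 0 * ψ i + transferProd w i n 0 1 * ψ (i - 1) = ψ (i + n) ∧
    transferProd w i n 1 0 * ψ i + transferProd w i n 1 1 * ψ (i - 1) = ψ (i + n - 1) := by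
  induction n with
  | zero => simp [transferProd]
  | succ n ih =>
    obtain ⟨h1, h2⟩ := ih fun j hj hj' => h j hj (by push_cast; linarith)
    have h3 := h (i + n) (by linarith) (by push_cast; linarith)
    have e1 : i + ((n + 1 : ℕ) : ℤ) = i + n + 1 := by push_cast; ring
    have e2 : i + ((n + 1 : ℕ) : ℤ) - 1 = i + n := by push_cast; ring
    rw [e2, e1]
    simp only [transferProd, transferStep, Matrix.mul_apply, Fin.sum_univ_two, Matrix.of_apply,
      Matrix.cons_val', Matrix.cons_val_zero, Matrix.cons_val_one, Matrix.cons_val_fin_one]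
    constructor
    · linear_combination w (i + n) * h1 - h2 - h3
    · linear_combination h1

/-- A solution on `(q - p, q + p)` of an equation with `p`-periodic coefficients satisfies a three
term recurrence with step `p`, whose coefficient is the trace of the transfer matrix. -/
theorem add_eq_trace_mul {w ψ : ℤ → ℝ} {p : ℕ} (hp : 0 < p) (hw : Function.Periodic w (p : ℤ))
    {q : ℤ} (h : ∀ i, q - p < i → i < q + p → ψ (i + 1) + ψ (i - 1) = w i * ψ i) :
    ψ (q + p) + ψ (q - p) = (transferProd w 0 p).trace * ψ q := by
  obtain ⟨n, rfl⟩ : ∃ n, p = n + 1 := ⟨p - 1, by omega⟩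
  obtain ⟨h1, h2⟩ := transferProd_mulVec (w := w) (ψ := ψ) (i := q - (n + 1 : ℕ) + 1) (n := n + 1)
    fun j hj hj' => h j (by linarith) (by push_cast at *; linarith)
  -- Only `n = p - 1` steps forward, since nothing is assumed at `q + p`. The upper row of this
  -- shorter product is the lower row of the full one, so Cayley–Hamilton still applies.
  obtain ⟨h3, -⟩ := transferProd_mulVec (w := w) (ψ := ψ) (i := q + 1) (n := n)
    fun j hj hj' => h j (by push_cast at *; linarith) (by push_cast at *; linarith)
  have hA : transferProd w (q + 1) (n + 1) = transferProd w (q - (n + 1 : ℕ) + 1) (n + 1) := by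
    rw [← transferProd_add_int_mul hw (q - (n + 1 : ℕ) + 1) 1]
    congr 1
    ring
  rw [← trace_transferProd hw (q - (n + 1 : ℕ) + 1)]
  set B := transferProd w (q + 1) n
  have hdet := det_transferProd w (q - (n + 1 : ℕ) + 1) (n + 1)
  have h10 : transferProd w (q + 1) (n + 1) 1 0 = B 0 0 := transferProd_succ_one _ _ _ _
  have h11 : transferProd w (q + 1) (n + 1) 1 1 = B 0 1 := transferProd_succ_one _ _ _ _
  rw [hA] at h10 h11
  rw [← h10, ← h11] at h3
  rw [Matrix.det_fin_two] at hdet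
  rw [Matrix.trace_fin_two]
  set M := transferProd w (q - (n + 1 : ℕ) + 1) (n + 1)
  have e1 : q - ((n + 1 : ℕ) : ℤ) + 1 + ((n + 1 : ℕ) : ℤ) = q + 1 := by ring
  have e2 : q - ((n + 1 : ℕ) : ℤ) + 1 - 1 = q - ((n + 1 : ℕ) : ℤ) := by ring
  have e3 : q + 1 + (n : ℤ) = q + ((n + 1 : ℕ) : ℤ) := by push_cast; ring
  rw [e1, e2] at h1 h2
  rw [e3] at h3
  simp only [add_sub_cancel_right] at h2 h3
  linear_combination (-1 : ℝ) * h3 - M 1 0 * h1 + M 0 0 * h2 - ψ (q - (n + 1 : ℕ)) * hdet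

theorem IsSolution.eq_zero {v ψ : ℤ → ℝ} (hψ : IsSolution v ψ) {i : ℤ} (h0 : ψ i = 0)
    (h1 : ψ (i + 1) = 0) : ψ = 0 := by
  have key : ∀ k : ℤ, ψ (i + k) = 0 ∧ ψ (i + k + 1) = 0 := by
    intro k
    induction k using Int.induction_on with
    | zero => simpa using ⟨h0, h1⟩
    | succ k ih =>
      obtain ⟨ha, hb⟩ := ih
      have := hψ (i + k + 1)
      rw [add_sub_cancel_right, ha, hb, mul_zero, add_zero] at this
      exact ⟨by rw [← add_assoc]; exact hb, by rw [← add_assoc]; exact this⟩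
    | pred k ih =>
      obtain ⟨ha, hb⟩ := ih
      have := hψ (i + -k)
      rw [ha, hb, mul_zero, zero_add] at this
      have e : i + (-(k : ℤ) - 1) = i + -k - 1 := by ring
      rw [e, sub_add_cancel]
      exact ⟨this, ha⟩
  funext x
  simpa using (key (x - i)).1

/-- A function tending to zero at infinity attains the maximum of its modulus on any set on which
it does not vanish. -/
theorem exists_abs_max {ψ : ℤ → ℝ} (h0 : Tendsto ψ cofinite (nhds 0)) {H : Set ℤ} {x₀ : ℤ}
    (hx : x₀ ∈ H) (hne : ψ x₀ ≠ 0) : ∃ q ∈ H, ψ q ≠ 0 ∧ ∀ x ∈ H, |ψ x| ≤ |ψ q| := by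
  have hpos : 0 < |ψ x₀| := abs_pos.2 hne
  have hfin : {x : ℤ | |ψ x₀| ≤ |ψ x|}.Finite := by
    have h1 := h0.abs
    rw [abs_zero] at h1
    have h2 := h1.eventually (gt_mem_nhds hpos)
    rw [eventually_cofinite] at h2
    simpa using h2
  obtain ⟨q, ⟨hqH, hq⟩, hmax⟩ := Set.exists_max_image (H ∩ {x : ℤ | |ψ x₀| ≤ |ψ x|})
    (fun x => |ψ x|) (hfin.subset Set.inter_subset_right) ⟨x₀, hx, le_refl |ψ x₀|⟩
  refine ⟨q, hqH, abs_pos.1 (hpos.trans_le hq), fun x hxH => ?_⟩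
  rcases le_total |ψ x₀| |ψ x| with h3 | h3
  · exact hmax x ⟨hxH, h3⟩
  · exact h3.trans hq

theorem sum_range_le_tsum_int {f : ℤ → ℝ} (hf : Summable f) (h0 : ∀ x, 0 ≤ f x) (a : ℤ) (n : ℕ) :
    ∑ j ∈ Finset.range n, f (a + j) ≤ ∑' x, f x := by
  have hinj : Function.Injective fun j : ℕ => a + (j : ℤ) := fun i j hij => by
    simpa using hij
  have := hf.sum_le_tsum ((Finset.range n).map ⟨_, hinj⟩) fun x _ => h0 x
  simpa [Finset.sum_map] using this

/-! ### Wronskian of a solution and its translate -/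

/-- The Wronskian of a solution and its translate by `p`. -/
def shiftWronskian (ψ : ℤ → ℝ) (p : ℕ) (i : ℤ) : ℝ :=
  ψ i * ψ (i + p + 1) - ψ (i + 1) * ψ (i + p)

/-- The Wronskian is conserved as long as the coefficients at `i` and `i + p` agree. -/
theorem IsSolution.shiftWronskian_eq {v ψ : ℤ → ℝ} (hψ : IsSolution v ψ) {p : ℕ} {L : ℤ}
    (hv : ∀ i, L < i → i < L + p → v (i + p) = v i) {j : ℕ} (hj : j < p) :
    shiftWronskian ψ p (L + j) = shiftWronskian ψ p L := by
  induction j with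
  | zero => simp
  | succ j ih =>
    rw [← ih (by omega)]
    have h1 := hψ (L + j + 1)
    have h2 := hψ (L + j + 1 + p)
    rw [hv (L + j + 1) (by omega) (by omega)] at h2
    have e1 : L + j + 1 + (p : ℤ) - 1 = L + j + p := by ring
    have e2 : L + j + (p : ℤ) + 1 = L + j + 1 + p := by ring
    simp only [shiftWronskian]
    push_cast
    rw [← add_assoc, e2]
    rw [e1] at h2
    rw [add_sub_cancel_right] at h1
    linear_combination ψ (L + j + 1) * h2 - ψ (L + j + 1 + p) * h1

/-- Sum the `p` equal values and bound each product by squares; each of the four resulting sums is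
part of the `ℓ²` norm squared. -/
theorem IsSolution.mul_abs_shiftWronskian_le {v ψ : ℤ → ℝ} (hψ : IsSolution v ψ)
    (hs : Summable fun x => ψ x ^ 2) {p : ℕ} {L : ℤ}
    (hv : ∀ i, L < i → i < L + p → v (i + p) = v i) :
    p * |shiftWronskian ψ p L| ≤ 2 * ∑' x, ψ x ^ 2 := by
  have hb : ∀ a : ℤ, ∑ j ∈ Finset.range p, ψ (a + j) ^ 2 ≤ ∑' x, ψ x ^ 2 := fun a =>
    sum_range_le_tsum_int hs (fun x => sq_nonneg _) a p
  have h1 : (p : ℝ) * |shiftWronskian ψ p L| = ∑ j ∈ Finset.range p, |shiftWronskian ψ p (L + j)| := by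
    rw [Finset.sum_congr rfl fun j hj => by
      rw [hψ.shiftWronskian_eq hv (Finset.mem_range.1 hj)]]
    simp
  have h2 : ∀ j : ℕ, |shiftWronskian ψ p (L + j)| ≤ (ψ (L + j) ^ 2 + ψ (L + p + 1 + j) ^ 2
      + ψ (L + 1 + j) ^ 2 + ψ (L + p + j) ^ 2) / 2 := by
    intro j
    have e1 : L + j + (p : ℤ) + 1 = L + p + 1 + j := by ring
    have e2 : L + (j : ℤ) + 1 = L + 1 + j := by ring
    have e3 : L + j + (p : ℤ) = L + p + j := by ring
    rw [shiftWronskian, e1, e2, e3, abs_le]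
    constructor <;>
    nlinarith [sq_nonneg (ψ (L + j) - ψ (L + p + 1 + j)), sq_nonneg (ψ (L + j) + ψ (L + p + 1 + j)),
      sq_nonneg (ψ (L + 1 + j) - ψ (L + p + j)), sq_nonneg (ψ (L + 1 + j) + ψ (L + p + j))]
  rw [h1]
  refine (Finset.sum_le_sum fun j _ => h2 j).trans ?_
  rw [← Finset.sum_div, Finset.sum_add_distrib, Finset.sum_add_distrib, Finset.sum_add_distrib]
  linarith [hb L, hb (L + p + 1), hb (L + 1), hb (L + p)]

/-! ### Filled potentials and their traces -/

/-- The sequence `v` with all holes of the class `h + p ℤ` filled by `c`. -/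
def fillHoles (v : ℤ → ℝ) (p : ℕ) (h : ℤ) (c : ℝ) : ℤ → ℝ :=
  fun x => if (p : ℤ) ∣ x - h then c else v x

theorem PeriodicOffClass.fillHoles_periodic {v : ℤ → ℝ} {p : ℕ} {h : ℤ}
    (hv : PeriodicOffClass v p h) (c : ℝ) : Function.Periodic (fillHoles v p h c) (p : ℤ) := by
  intro x
  have e : x + (p : ℤ) - h = x - h + p := by ring
  simp only [fillHoles, e, dvd_add_self_right]
  split_ifs with hd
  · rfl
  · exact hv x hd

/-- The trace of the transfer matrix over one period of `v` with its holes filled by `c`. -/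
def holeTrace (v : ℤ → ℝ) (p : ℕ) (h : ℤ) (c : ℝ) : ℝ :=
  (transferProd (fillHoles v p h c) 0 p).trace

theorem PeriodicOffClass.add_eq_holeTrace_mul {v ψ : ℤ → ℝ} {p : ℕ} {h : ℤ}
    (hv : PeriodicOffClass v p h) (hp : 0 < p) (hψ : IsSolution v ψ) {q : ℤ} {c : ℝ}
    (hc : ∀ i, q - p < i → i < q + p → (p : ℤ) ∣ i - h → v i = c) :
    ψ (q + p) + ψ (q - p) = holeTrace v p h c * ψ q := by
  refine add_eq_trace_mul hp (hv.fillHoles_periodic c) fun i hi hi' => ?_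
  rw [hψ i, fillHoles]
  split_ifs with hd
  · rw [hc i hi hi' hd]
  · rfl

/-- A solution that tends to zero at infinity and vanishes at all holes vanishes identically, if
one of the traces has modulus larger than two. -/
theorem PeriodicOffClass.eq_zero_of_hole_eq_zero {v ψ : ℤ → ℝ} {p : ℕ} {h : ℤ}
    (hv : PeriodicOffClass v p h) (hp : 0 < p) (hψ : IsSolution v ψ)
    (h0 : Tendsto ψ cofinite (nhds 0)) {c : ℝ} (hc : 2 < |holeTrace v p h c|)
    (hz : ∀ x : ℤ, (p : ℤ) ∣ x - h → ψ x = 0) : ψ = 0 := by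
  by_contra hne
  obtain ⟨x₀, hx₀⟩ := Function.ne_iff.1 hne
  obtain ⟨q, -, hq, hmax⟩ := exists_abs_max h0 (Set.mem_univ x₀) hx₀
  have h1 : ψ (q + p) + ψ (q - p) = holeTrace v p h c * ψ q := by
    refine add_eq_trace_mul hp (hv.fillHoles_periodic c) fun i _ _ => ?_
    rw [hψ i, fillHoles]
    split_ifs with hd
    · rw [hz i hd, mul_zero, mul_zero]
    · rfl
  have h2 := congrArg abs h1
  rw [abs_mul] at h2
  have h3 := abs_add_le (ψ (q + p)) (ψ (q - p))
  have h4 := hmax (q + p) trivial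
  have h5 := hmax (q - p) trivial
  have h6 := abs_pos.2 hq
  nlinarith

/-! ### Bounded traces and enclosing holes -/

/-- The multiples of `p` strictly between two bounds. -/
theorem eq_mul_of_dvd_of_lt {p : ℕ} {x : ℤ} (hx : (p : ℤ) ∣ x) {a b : ℤ} (h1 : a * p < x)
    (h2 : x < b * p) : ∃ m : ℤ, x = m * p ∧ a < m ∧ m < b := by
  obtain ⟨m, rfl⟩ := hx
  have hp : (0 : ℤ) ≤ p := by positivity
  exact ⟨m, mul_comm _ _, by nlinarith, by nlinarith⟩

/-- At level `(p, h)`, the site `q` lies strictly between two neighbouring holes, the left one being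
`L`, both of which are filled with `c`. -/
structure IsEnclosed (v : ℤ → ℝ) (p : ℕ) (h : ℤ) (c : ℝ) (q L : ℤ) : Prop where
  hole : (p : ℤ) ∣ L - h
  lt : L < q
  lt_add : q < L + p
  left_eq : v L = c
  right_eq : v (L + p) = c

namespace IsConstantTower

variable {v ψ : ℤ → ℝ} {p : ℕ → ℕ} {h : ℕ → ℤ} {z : ℕ → ℝ}

/-- The trace of the transfer matrix of level `k` with the holes filled by the letter of that
level. -/
noncomputable def levelTrace (v : ℤ → ℝ) (p : ℕ → ℕ) (h : ℕ → ℤ) (z : ℕ → ℝ) (k : ℕ) : ℝ :=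
  holeTrace v (p k) (h k) (z k)

/-- Otherwise take a hole `q` of level `K` maximizing `|ψ|` among these holes. If `q` is a hole of
level `k` with letter `z k`, the recurrence with step `p k` contradicts maximality. So `q` is never
removed, yet its letter is `z k` for some `k ≥ K`. -/
theorem exists_abs_levelTrace_le (T : IsConstantTower v p h z)
    (hz : ∀ x K, ∃ k, K ≤ k ∧ z k = v x) (hψ : IsSolution v ψ)
    (h0 : Tendsto ψ cofinite (nhds 0)) (hne : ψ ≠ 0) (K : ℕ) :
    ∃ k, K ≤ k ∧ |levelTrace v p h z k| ≤ 2 := by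
  by_contra! hcon
  obtain ⟨x₀, hx₀, hx₀'⟩ : ∃ x : ℤ, (p K : ℤ) ∣ x - h K ∧ ψ x ≠ 0 := by
    by_contra! hall
    exact hne ((T.periodic K).eq_zero_of_hole_eq_zero (T.pos K) hψ h0 (hcon K le_rfl) hall)
  obtain ⟨q, hqK, hq, hmax⟩ := exists_abs_max (H := {x : ℤ | (p K : ℤ) ∣ x - h K}) h0 hx₀ hx₀'
  have key : ∀ k, K ≤ k → (p k : ℤ) ∣ q - h k → v q ≠ z k := by
    intro k hk hqk hvq
    have hp : (0 : ℤ) < p k := by exact_mod_cast T.pos k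
    have h1 := (T.periodic k).add_eq_holeTrace_mul (T.pos k) hψ (q := q) (c := z k) <| by
      intro i hi hi' hd
      have h2 : (p k : ℤ) ∣ i - q := by simpa using dvd_sub hd hqk
      have h3 := Int.eq_zero_of_abs_lt_dvd h2 (by rw [abs_lt]; constructor <;> linarith)
      rw [← hvq]
      congr 1
      linarith
    have h2 := congrArg abs h1
    rw [abs_mul] at h2
    have h3 := abs_add_le (ψ (q + p k)) (ψ (q - p k))
    have e1 : q + (p k : ℤ) - h k = q - h k + p k := by ring
    have e2 : q - (p k : ℤ) - h k = q - h k - p k := by ring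
    have h4 := hmax (q + p k) (T.hole_of_le hk (by rw [e1]; exact dvd_add hqk dvd_rfl))
    have h5 := hmax (q - p k) (T.hole_of_le hk (by rw [e2]; exact dvd_sub hqk dvd_rfl))
    have h6 := abs_pos.2 hq
    have h7 : 2 < |holeTrace v (p k) (h k) (z k)| := hcon k hk
    nlinarith
  have hhole : ∀ k, K ≤ k → (p k : ℤ) ∣ q - h k := by
    intro k hk
    induction k, hk using Nat.le_induction with
    | base => exact hqK
    | succ k hk ih =>
      by_contra hd
      exact key k hk ih (T.letter ih hd)
  obtain ⟨k, hk, hzk⟩ := hz q K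
  exact key k hk (hhole k hk) hzk.symm

theorem eventually_small (T : IsConstantTower v p h z) (h0 : Tendsto ψ cofinite (nhds 0)) {q : ℤ}
    {ε : ℝ} (hε : 0 < ε) : ∃ K, ∀ k, K ≤ k → |ψ (q + p k)| < ε ∧ |ψ (q - p k)| < ε ∧
      |ψ (q + p k + p k)| < ε ∧ |ψ (q - p k - p k)| < ε := by
  have hmono : StrictMono p := strictMono_nat_of_lt_succ fun k => by
    obtain ⟨n, hn, hp⟩ := T.exists_mul k
    have := T.pos k
    rw [hp]
    nlinarith
  have hsmall : ∀ f : ℕ → ℤ, Function.Injective f → ∀ᶠ k in atTop, |ψ (f k)| < ε := by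
    intro f hf
    have h1 := (h0.comp (hf.tendsto_cofinite)).abs
    rw [Nat.cofinite_eq_atTop, abs_zero] at h1
    exact h1.eventually (gt_mem_nhds hε)
  have hinj : ∀ i j, (p i : ℤ) = p j → i = j := fun i j hij =>
    hmono.injective (by exact_mod_cast hij)
  have h1 := hsmall (fun k => q + p k) fun i j hij => hinj i j (by simp only at hij; linarith)
  have h2 := hsmall (fun k => q - p k) fun i j hij => hinj i j (by simp only at hij; linarith)
  have h3 := hsmall (fun k => q + p k + p k) fun i j hij => hinj i j (by simp only at hij; linarith)
  have h4 := hsmall (fun k => q - p k - p k) fun i j hij => hinj i j (by simp only at hij; linarith)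
  obtain ⟨K, hK⟩ := eventually_atTop.1 (h1.and (h2.and (h3.and h4)))
  exact ⟨K, hK⟩

/-- The two-block argument: if the trace of level `k` is bounded and the solution is small at
distances `p k` and `2 p k` from `q`, then on both sides of `q` some hole within distance `2 p k`
does not carry the letter `z k`. -/
theorem exists_hole_ne (T : IsConstantTower v p h z) (hψ : IsSolution v ψ) {q : ℤ} {k : ℕ}
    (hq : ψ q ≠ 0) (ht : |levelTrace v p h z k| ≤ 2)
    (hs : |ψ (q + p k)| < |ψ q| / 10 ∧ |ψ (q - p k)| < |ψ q| / 10 ∧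
      |ψ (q + p k + p k)| < |ψ q| / 10 ∧ |ψ (q - p k - p k)| < |ψ q| / 10) :
    (∃ i, q < i ∧ i < q + 2 * p k ∧ (p k : ℤ) ∣ i - h k ∧ v i ≠ z k) ∧
    ∃ i, q - 2 * p k < i ∧ i < q ∧ (p k : ℤ) ∣ i - h k ∧ v i ≠ z k := by
  obtain ⟨hs1, hs2, hs3, hs4⟩ := hs
  have hpos := abs_pos.2 hq
  -- With `|t| ≤ 2`, equality would give `|ψ q| ≤ 2/10 |ψ q| + 1/10 |ψ q|`.
  have key : ∀ x y : ℝ, |x| < |ψ q| / 10 → |y| < |ψ q| / 10 →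
      ψ q + y ≠ levelTrace v p h z k * x := by
    intro x y hx hy hxy
    have h1 : |ψ q| ≤ |levelTrace v p h z k * x| + |y| := by
      rw [← hxy]
      have := abs_add_le (ψ q + y) (-y)
      rw [abs_neg] at this
      simpa using this
    rw [abs_mul] at h1
    have h2 := abs_nonneg x
    nlinarith
  constructor
  · by_contra! hall
    have h1 := (T.periodic k).add_eq_holeTrace_mul (T.pos k) hψ (q := q + p k) (c := z k)
      fun i hi hi' hd => hall i (by linarith) (by linarith) hd
    rw [add_sub_cancel_right, add_comm] at h1
    exact key _ _ hs1 hs3 h1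
  · by_contra! hall
    have h1 := (T.periodic k).add_eq_holeTrace_mul (T.pos k) hψ (q := q - p k) (c := z k)
      fun i hi hi' hd => hall i (by linarith) (by linarith) hd
    rw [sub_add_cancel] at h1
    exact key _ _ hs2 hs4 h1

/-- Two neighbouring holes with equal letters carry the letter of their level. -/
theorem eq_letter (T : IsConstantTower v p h z) {k : ℕ} {i : ℤ} (hi : (p k : ℤ) ∣ i - h k)
    (heq : v i = v (i + p k)) : v i = z k := by
  by_contra hne
  have h1 : (p (k + 1) : ℤ) ∣ i - h (k + 1) := by
    by_contra hd
    exact hne (T.letter hi hd)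
  have h2 : (p (k + 1) : ℤ) ∣ i + p k - h (k + 1) := by
    by_contra hd
    refine hne (heq.trans (T.letter ?_ hd))
    have e : i + (p k : ℤ) - h k = i - h k + p k := by ring
    rw [e]
    exact dvd_add hi dvd_rfl
  have h3 : (p (k + 1) : ℤ) ∣ p k := by
    have := dvd_sub h2 h1
    have e : i + (p k : ℤ) - h (k + 1) - (i - h (k + 1)) = p k := by ring
    rwa [e] at this
  obtain ⟨n, hn, hp⟩ := T.exists_mul k
  have h4 := Nat.le_of_dvd (T.pos k) (by exact_mod_cast h3 : p (k + 1) ∣ p k)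
  have := T.pos k
  nlinarith

/-- Holes of level `k` not filled with `z k` on either side of `q`, less than `4 p` apart, are
neighbouring holes of the next level, and enclose `q`. -/
theorem isEnclosed_succ (T : IsConstantTower v p h z)
    (h2 : ∀ k x y, v x ≠ z k → v y ≠ z k → v x = v y) {k : ℕ} {q i j : ℤ} (hi : i < q) (hj : q < j)
    (hij : j - i < 4 * p k) (hid : (p k : ℤ) ∣ i - h k) (hjd : (p k : ℤ) ∣ j - h k)
    (hiz : v i ≠ z k) (hjz : v j ≠ z k) :
    IsEnclosed v (p (k + 1)) (h (k + 1)) (z (k + 1)) q i ∧ j = i + p (k + 1) := by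
  have hid' : (p (k + 1) : ℤ) ∣ i - h (k + 1) := by
    by_contra hd
    exact hiz (T.letter hid hd)
  have hjd' : (p (k + 1) : ℤ) ∣ j - h (k + 1) := by
    by_contra hd
    exact hjz (T.letter hjd hd)
  obtain ⟨n, hn, hp⟩ := T.exists_mul k
  have hpos := T.pos k
  -- Both sites survive to level `k + 1`, and `4 * p k ≤ 2 * p (k + 1)` leaves room for only one
  -- period.
  have hji : j = i + p (k + 1) := by
    have h3 : (p (k + 1) : ℤ) ∣ j - i := by simpa using dvd_sub hjd' hid'
    have h4 : (4 : ℤ) * p k ≤ 2 * p (k + 1) := by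
      rw [hp]
      push_cast
      nlinarith
    obtain ⟨m, hm, hm0, hm2⟩ := eq_mul_of_dvd_of_lt h3 (a := 0) (b := 2) (by linarith) (by linarith)
    obtain rfl : m = 1 := by omega
    linarith
  have heq : v i = v (i + p (k + 1)) := by
    rw [← hji]
    exact h2 k i j hiz hjz
  have hl := T.eq_letter hid' heq
  exact ⟨⟨hid', hi, hji ▸ hj, hl, heq ▸ hl⟩, hji⟩

/-- The only holes within distance less than `p k` of `q` are the enclosing ones, which carry `z k`;
so `t * ψ q` is a sum of two terms below `|ψ q| / 10`. -/
theorem abs_levelTrace_le_of_isEnclosed (T : IsConstantTower v p h z) (hψ : IsSolution v ψ) {q L : ℤ}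
    {k : ℕ} (hq : ψ q ≠ 0) (hs : |ψ (q + p k)| < |ψ q| / 10 ∧ |ψ (q - p k)| < |ψ q| / 10)
    (hE : IsEnclosed v (p k) (h k) (z k) q L) : |levelTrace v p h z k| ≤ 1 / 5 := by
  have h1 := (T.periodic k).add_eq_holeTrace_mul (T.pos k) hψ (q := q) (c := z k) <| by
    intro i hi hi' hd
    have h3 : (p k : ℤ) ∣ i - L := by simpa using dvd_sub hd hE.hole
    have := hE.lt
    have := hE.lt_add
    obtain ⟨m, hm, hm0, hm2⟩ := eq_mul_of_dvd_of_lt h3 (a := -1) (b := 2) (by linarith) (by linarith)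
    obtain rfl | rfl : m = 0 ∨ m = 1 := by omega
    · rw [← hE.left_eq]
      congr 1
      linarith
    · rw [← hE.right_eq]
      congr 1
      linarith
  have h2 := congrArg abs h1
  rw [abs_mul] at h2
  have h3 := abs_add_le (ψ (q + p k)) (ψ (q - p k))
  have h6 := abs_pos.2 hq
  change |holeTrace v (p k) (h k) (z k)| ≤ 1 / 5
  by_contra! hcon
  nlinarith [hs.1, hs.2]

/-- The two-block argument needs holes with the other letter within `2 * p k` on both sides. The
enclosing holes carry `z k`, which leaves only `L - p k` and `L + 2 * p k`; their distance `3 * p k`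
must be the next period. -/
theorem isEnclosed_step (T : IsConstantTower v p h z)
    (h2 : ∀ k x y, v x ≠ z k → v y ≠ z k → v x = v y) (hψ : IsSolution v ψ) {q L : ℤ} {k : ℕ}
    (hq : ψ q ≠ 0) (hs : |ψ (q + p k)| < |ψ q| / 10 ∧ |ψ (q - p k)| < |ψ q| / 10 ∧
      |ψ (q + p k + p k)| < |ψ q| / 10 ∧ |ψ (q - p k - p k)| < |ψ q| / 10)
    (hE : IsEnclosed v (p k) (h k) (z k) q L) :
    |levelTrace v p h z k| ≤ 1 / 5 ∧ p (k + 1) = 3 * p k ∧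
      IsEnclosed v (p (k + 1)) (h (k + 1)) (z (k + 1)) q (L - p k) := by
  have ht := T.abs_levelTrace_le_of_isEnclosed hψ hq ⟨hs.1, hs.2.1⟩ hE
  obtain ⟨⟨j, hj, hj', hjd, hjz⟩, i, hi, hi', hid, hiz⟩ :=
    T.exists_hole_ne hψ hq (ht.trans (by norm_num)) hs
  have hlt := hE.lt
  have hlt' := hE.lt_add
  have hj2 : j = L + 2 * p k := by
    have h3 : (p k : ℤ) ∣ j - L := by simpa using dvd_sub hjd hE.hole
    obtain ⟨m, hm, hm0, hm2⟩ := eq_mul_of_dvd_of_lt h3 (a := 0) (b := 3) (by linarith) (by linarith)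
    obtain rfl | rfl : m = 1 ∨ m = 2 := by omega
    · exact absurd (by rw [← hE.right_eq]; congr 1; linarith) hjz
    · linarith
  have hi2 : i = L - p k := by
    have h3 : (p k : ℤ) ∣ i - L := by simpa using dvd_sub hid hE.hole
    obtain ⟨m, hm, hm0, hm2⟩ := eq_mul_of_dvd_of_lt h3 (a := -2) (b := 1) (by linarith) (by linarith)
    obtain rfl | rfl : m = -1 ∨ m = 0 := by omega
    · linarith
    · exact absurd (by rw [← hE.left_eq]; congr 1; linarith) hiz
  have hp : (0 : ℤ) < p k := by exact_mod_cast T.pos k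
  obtain ⟨hE', hji⟩ := T.isEnclosed_succ h2 hi' hj (by linarith) hid hjd hiz hjz
  refine ⟨ht, ?_, hi2 ▸ hE'⟩
  have : (p (k + 1) : ℤ) = 3 * p k := by linarith
  exact_mod_cast this

/-! ### Growth against decay at the enclosing holes -/

/-- The lower left entry of the transfer matrix from hole to hole. -/
noncomputable def offDiagonal (v : ℤ → ℝ) (p : ℕ → ℕ) (h : ℕ → ℤ) (z : ℕ → ℝ) (k : ℕ) : ℝ :=
  transferProd (fillHoles v (p k) (h k) (z k)) (h k + 1) (p k) 1 0

/-- The lower row does not see the last site, the hole of level `k + 1`, so the entry is that of the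
cube of the level `k` matrix `M`; Cayley–Hamilton gives `M ^ 3 = (t ^ 2 - 1) M - t`. -/
theorem offDiagonal_succ (T : IsConstantTower v p h z) {k : ℕ} (h3 : p (k + 1) = 3 * p k) :
    offDiagonal v p h z (k + 1) = (levelTrace v p h z k ^ 2 - 1) * offDiagonal v p h z k := by
  have hper := (T.periodic k).fillHoles_periodic (z k)
  set w := fillHoles v (p k) (h k) (z k) with hw
  obtain ⟨d, hd⟩ := (T.step k).dvd_sub
  have hloc : ∀ n : ℕ, n + 1 ≤ p (k + 1) →
      transferProd (fillHoles v (p (k + 1)) (h (k + 1)) (z (k + 1))) (h (k + 1) + 1) n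
        = transferProd w (h (k + 1) + 1) n := by
    intro n
    induction n with
    | zero => intro _; rfl
    | succ n ih =>
      intro hn
      have hx : ¬ (p (k + 1) : ℤ) ∣ h (k + 1) + 1 + n - h (k + 1) := by
        intro hdv
        have := Int.eq_zero_of_abs_lt_dvd hdv (by rw [abs_lt]; omega)
        omega
      rw [transferProd, transferProd, ih (by omega)]
      congr 2
      simp only [hw, fillHoles, if_neg hx]
      split_ifs with hx'
      · exact T.letter hx' hx
      · rfl
  have h1 : offDiagonal v p h z (k + 1) = transferProd w (h (k + 1) + 1) (p (k + 1)) 1 0 := by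
    unfold offDiagonal
    obtain ⟨n, hn⟩ : ∃ n, p (k + 1) = n + 1 := ⟨p (k + 1) - 1, by have := T.pos (k + 1); omega⟩
    have h4 := hloc n hn.ge
    rw [hn] at h4 ⊢
    rw [transferProd_succ_one, transferProd_succ_one, h4]
  have h4 : transferProd w (h (k + 1) + 1) (p (k + 1)) = transferProd w (h k + 1) (p k) ^ 3 := by
    rw [h3, transferProd_mul hper]
    congr 1
    rw [← transferProd_add_int_mul hper (h k + 1) d]
    congr 1
    simp only at hd
    linarith
  have h5 : levelTrace v p h z k = (transferProd w (h k + 1) (p k)).trace :=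
    (trace_transferProd hper _).symm
  have h6 := det_transferProd w (h k + 1) (p k)
  rw [h1, h4, h5]
  unfold offDiagonal
  rw [← hw]
  set M := transferProd w (h k + 1) (p k)
  rw [Matrix.det_fin_two] at h6
  rw [Matrix.trace_fin_two, pow_succ, pow_two]
  simp only [Matrix.mul_apply, Fin.sum_univ_two]
  linear_combination (-M 1 0) * h6

/-- The transfer matrix across the block that encloses `q`. -/
theorem exists_matrix (T : IsConstantTower v p h z) (hψ : IsSolution v ψ) {q L : ℤ} {k : ℕ}
    (hE : IsEnclosed v (p k) (h k) (z k) q L) : ∃ a b d : ℝ,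
      a * d - b * offDiagonal v p h z k = 1 ∧ a + d = levelTrace v p h z k ∧
      a * ψ (L + 1) + b * ψ L = ψ (L + p k + 1) ∧
      offDiagonal v p h z k * ψ (L + 1) + d * ψ L = ψ (L + p k) := by
  have hper := (T.periodic k).fillHoles_periodic (z k)
  obtain ⟨m, hm⟩ := hE.hole
  have h1 : transferProd (fillHoles v (p k) (h k) (z k)) (L + 1) (p k)
      = transferProd (fillHoles v (p k) (h k) (z k)) (h k + 1) (p k) := by
    rw [← transferProd_add_int_mul hper (h k + 1) m]
    congr 1
    linarith
  obtain ⟨h2, h3⟩ := transferProd_mulVec (w := fillHoles v (p k) (h k) (z k)) (ψ := ψ) (i := L + 1)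
    (n := p k) <| by
      intro j hj hj'
      rw [hψ j, fillHoles]
      split_ifs with hd
      · have h4 : (p k : ℤ) ∣ j - L := by simpa using dvd_sub hd hE.hole
        have hp : (0 : ℤ) < p k := by exact_mod_cast T.pos k
        obtain ⟨m, hm, hm0, hm2⟩ := eq_mul_of_dvd_of_lt h4 (a := 0) (b := 2) (by linarith)
          (by linarith)
        obtain rfl : m = 1 := by omega
        have h5 : j = L + p k := by linarith
        rw [h5, hE.right_eq]
      · rfl
  have h4 := det_transferProd (fillHoles v (p k) (h k) (z k)) (h k + 1) (p k)
  have h5 := trace_transferProd hper (h k + 1)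
  rw [h1] at h2 h3
  rw [Matrix.det_fin_two] at h4
  rw [Matrix.trace_fin_two] at h5
  have e1 : L + 1 + (p k : ℤ) = L + p k + 1 := by ring
  rw [e1] at h2 h3
  rw [add_sub_cancel_right] at h2 h3
  rw [add_sub_cancel_right] at h3
  exact ⟨_, _, _, h4, h5, h2, h3⟩

theorem hole_relations (T : IsConstantTower v p h z) (hψ : IsSolution v ψ) {q L : ℤ} {k : ℕ}
    (hE : IsEnclosed v (p k) (h k) (z k) q L) :
    ψ (L + p k) + ψ (L - p k) = levelTrace v p h z k * ψ L ∧
    ψ (L + p k + p k) + ψ L = levelTrace v p h z k * ψ (L + p k) := by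
  have key : ∀ x : ℤ, (p k : ℤ) ∣ x - h k → v x = z k →
      ψ (x + p k) + ψ (x - p k) = levelTrace v p h z k * ψ x := by
    intro x hx hv
    refine (T.periodic k).add_eq_holeTrace_mul (T.pos k) hψ fun i hi hi' hd => ?_
    have h2 : (p k : ℤ) ∣ i - x := by simpa using dvd_sub hd hx
    have h3 := Int.eq_zero_of_abs_lt_dvd h2 (by rw [abs_lt]; constructor <;> linarith)
    rw [← hv]
    congr 1
    linarith
  refine ⟨key L hE.hole hE.left_eq, ?_⟩
  have e : L + (p k : ℤ) - h k = L - h k + p k := by ring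
  have := key (L + p k) (by rw [e]; exact dvd_add hE.hole dvd_rfl) hE.right_eq
  rwa [add_sub_cancel_right] at this

/-- The size of the solution at the two enclosing holes is controlled by the Wronskian. -/
theorem sq_add_sq_le (T : IsConstantTower v p h z) (hψ : IsSolution v ψ) {q L : ℤ} {k : ℕ}
    (hE : IsEnclosed v (p k) (h k) (z k) q L) (ht : |levelTrace v p h z k| ≤ 1 / 5) :
    ψ L ^ 2 + ψ (L + p k) ^ 2
      ≤ 2 * (|offDiagonal v p h z k| * |shiftWronskian ψ (p k) L|) := by
  obtain ⟨a, b, d, h1, h2, h3, h4⟩ := T.exists_matrix hψ hE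
  -- Eliminating `ψ (L + 1)` leaves a quadratic form in the two hole values, which is definite
  -- because the trace is small.
  have h5 : offDiagonal v p h z k * shiftWronskian ψ (p k) L
      = levelTrace v p h z k * (ψ L * ψ (L + p k)) - ψ L ^ 2 - ψ (L + p k) ^ 2 := by
    rw [shiftWronskian, ← h2, ← h3, ← h4]
    linear_combination (-ψ L ^ 2) * h1
  have h6 := neg_abs_le (offDiagonal v p h z k * shiftWronskian ψ (p k) L)
  rw [abs_mul, h5] at h6
  rw [abs_le] at ht
  nlinarith [sq_nonneg (ψ L - ψ (L + p k)), sq_nonneg (ψ L + ψ (L + p k)), ht.1, ht.2]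

/-- If both values vanish, either `ψ (L + 1) = 0` too and `ψ = 0`, or the matrix is triangular with
determinant `1`, so its trace has modulus at least `2`. -/
theorem sq_add_sq_pos (T : IsConstantTower v p h z) (hψ : IsSolution v ψ) (hne : ψ ≠ 0) {q L : ℤ}
    {k : ℕ} (hE : IsEnclosed v (p k) (h k) (z k) q L) (ht : |levelTrace v p h z k| ≤ 1 / 5) :
    0 < ψ L ^ 2 + ψ (L + p k) ^ 2 := by
  obtain ⟨a, b, d, h1, h2, -, h4⟩ := T.exists_matrix hψ hE
  by_contra! hcon
  have hL : ψ L = 0 := by nlinarith [sq_nonneg (ψ L), sq_nonneg (ψ (L + p k))]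
  have hR : ψ (L + p k) = 0 := by nlinarith [sq_nonneg (ψ L), sq_nonneg (ψ (L + p k))]
  rw [hL, hR, mul_zero, add_zero, mul_eq_zero] at h4
  rcases h4 with h4 | h4
  · rw [h4, mul_zero, sub_zero] at h1
    rw [abs_le] at ht
    nlinarith [sq_nonneg (a - d), sq_nonneg (a + d)]
  · exact hne (hψ.eq_zero hL h4)

/-- A square-summable solution for a two-letter constant tower, both of whose letters are used in
infinitely many steps, vanishes. -/
theorem solution_eq_zero (T : IsConstantTower v p h z)
    (h2 : ∀ k x y, v x ≠ z k → v y ≠ z k → v x = v y) (hz : ∀ x K, ∃ k, K ≤ k ∧ z k = v x)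
    (hψ : IsSolution v ψ) (hs : Summable fun x => ψ x ^ 2) : ψ = 0 := by
  by_contra hne
  have h0 : Tendsto ψ cofinite (nhds 0) := by
    have h1 := hs.tendsto_cofinite_zero
    have h3 := h1.sqrt
    simp only [Real.sqrt_sq_eq_abs, Real.sqrt_zero] at h3
    exact (tendsto_zero_iff_abs_tendsto_zero ψ).2 h3
  obtain ⟨q, hq⟩ := Function.ne_iff.1 hne
  have hq : ψ q ≠ 0 := hq
  obtain ⟨K₀, hK₀⟩ := T.eventually_small h0 (q := q) (ε := |ψ q| / 10)
    (by have := abs_pos.2 hq; linarith)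
  obtain ⟨k₀, hk₀, ht₀⟩ := T.exists_abs_levelTrace_le hz hψ h0 hne K₀
  obtain ⟨L₀, hE₀⟩ : ∃ L, IsEnclosed v (p (k₀ + 1)) (h (k₀ + 1)) (z (k₀ + 1)) q L := by
    obtain ⟨⟨j, hj, hj', hjd, hjz⟩, i, hi, hi', hid, hiz⟩ :=
      T.exists_hole_ne hψ hq ht₀ (hK₀ k₀ hk₀)
    exact ⟨i, (T.isEnclosed_succ h2 hi' hj (by linarith) hid hjd hiz hjz).1⟩
  set K := k₀ + 1 with hK
  set Y := |offDiagonal v p h z K| with hY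
  set F := ψ L₀ ^ 2 + ψ (L₀ + p K) ^ 2 with hF
  have hFpos : 0 < F := T.sq_add_sq_pos hψ hne hE₀
    (T.isEnclosed_step h2 hψ hq (hK₀ K (by omega)) hE₀).1
  have key : ∀ j : ℕ, ∃ L, IsEnclosed v (p (K + j)) (h (K + j)) (z (K + j)) q L ∧
      p (K + j) = 3 ^ j * p K ∧ |offDiagonal v p h z (K + j)| ≤ Y ∧
      (16 / 25 : ℝ) ^ j * F ≤ ψ L ^ 2 + ψ (L + p (K + j)) ^ 2 := by
    intro j
    induction j with
    | zero => exact ⟨L₀, hE₀, by simp, le_rfl, by simp [hF]⟩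
    | succ j ih =>
      obtain ⟨L, hE, hpj, hyj, hFj⟩ := ih
      obtain ⟨ht, h3, hE'⟩ := T.isEnclosed_step h2 hψ hq (hK₀ (K + j) (by omega)) hE
      obtain ⟨hr1, hr2⟩ := T.hole_relations hψ hE
      refine ⟨L - p (K + j), hE', ?_, ?_, ?_⟩
      · rw [← add_assoc, h3, hpj]
        ring
      · rw [← add_assoc, T.offDiagonal_succ h3, abs_mul]
        refine le_trans ?_ hyj
        refine mul_le_of_le_one_left (abs_nonneg _) ?_
        rw [abs_le] at ht ⊢
        constructor <;> nlinarith [ht.1, ht.2]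
      · have e : L - (p (K + j) : ℤ) + p (K + (j + 1)) = L + p (K + j) + p (K + j) := by
          rw [← add_assoc, h3]
          push_cast
          ring
        rw [e]
        have e1 : ψ (L - p (K + j)) = levelTrace v p h z (K + j) * ψ L - ψ (L + p (K + j)) := by
          linarith
        have e2 : ψ (L + p (K + j) + p (K + j))
            = levelTrace v p h z (K + j) * ψ (L + p (K + j)) - ψ L := by linarith
        rw [e1, e2, pow_succ]
        set t := levelTrace v p h z (K + j)
        set x := ψ L
        set y := ψ (L + p (K + j))
        rw [abs_le] at ht
        -- The map to the next pair of hole values is diagonal in `x + y` and `x - y`, with factors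
        -- of modulus `|1 - t|` and `|1 + t|`, both at least `4/5`.
        have h4 : (t * x - y) ^ 2 + (t * y - x) ^ 2
            = ((1 - t) ^ 2 * (x + y) ^ 2 + (1 + t) ^ 2 * (x - y) ^ 2) / 2 := by ring
        have h5 : (16 / 25 : ℝ) ≤ (1 - t) ^ 2 := by nlinarith [ht.1, ht.2]
        have h6 : (16 / 25 : ℝ) ≤ (1 + t) ^ 2 := by nlinarith [ht.1, ht.2]
        rw [h4]
        have h7 := mul_le_mul_of_nonneg_right h5 (sq_nonneg (x + y))
        have h8 := mul_le_mul_of_nonneg_right h6 (sq_nonneg (x - y))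
        nlinarith
  set S := ∑' x, ψ x ^ 2
  -- Here `48/25 = 3 * 16/25`: growth of the period times worst-case shrinking of the hole values.
  have hbound : ∀ j : ℕ, (48 / 25 : ℝ) ^ j * F ≤ 4 * Y * S := by
    intro j
    obtain ⟨L, hE, hpj, hyj, hFj⟩ := key j
    have ht := (T.isEnclosed_step h2 hψ hq (hK₀ (K + j) (by omega)) hE).1
    have h1 := T.sq_add_sq_le hψ hE ht
    have h3 := hψ.mul_abs_shiftWronskian_le hs (p := p (K + j)) (L := L) <| by
      intro i hi hi'
      refine T.periodic (K + j) i fun hd => ?_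
      have h4 : (p (K + j) : ℤ) ∣ i - L := by simpa using dvd_sub hd hE.hole
      have := Int.eq_zero_of_abs_lt_dvd h4 (by rw [abs_lt]; constructor <;> linarith)
      linarith
    set W := |shiftWronskian ψ (p (K + j)) L| with hW
    have hW0 : 0 ≤ W := abs_nonneg _
    have h4 : (3 : ℝ) ^ j ≤ p (K + j) := by
      rw [hpj]
      have : 1 ≤ p K := T.pos K
      exact_mod_cast Nat.le_mul_of_pos_right (3 ^ j) this
    have hY0 : 0 ≤ Y := abs_nonneg _
    have h5 : (16 / 25 : ℝ) ^ j * F ≤ 2 * (Y * W) :=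
      hFj.trans (h1.trans (by gcongr))
    calc (48 / 25 : ℝ) ^ j * F = 3 ^ j * ((16 / 25 : ℝ) ^ j * F) := by
          rw [← mul_assoc, ← mul_pow]; norm_num
      _ ≤ 3 ^ j * (2 * (Y * W)) := by gcongr
      _ = 2 * Y * (3 ^ j * W) := by ring
      _ ≤ 2 * Y * (p (K + j) * W) := by gcongr
      _ ≤ 2 * Y * (2 * S) := by gcongr
      _ = 4 * Y * S := by ring
  obtain ⟨j, hj⟩ := pow_unbounded_of_one_lt (4 * Y * S / F) (by norm_num : (1 : ℝ) < 48 / 25)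
  rw [div_lt_iff₀ hFpos] at hj
  linarith [hbound j]

end IsConstantTower

/-! ### Passing to the subshift -/

theorem IsConstantTower.map {A B : Type*} {V : ℤ → A} {p : ℕ → ℕ} {h : ℕ → ℤ} {z : ℕ → A}
    (T : IsConstantTower V p h z) (g : A → B) :
    IsConstantTower (fun x => g (V x)) p h (fun k => g (z k)) where
  pos_zero := T.pos_zero
  periodic_zero x hx := congrArg g (T.periodic_zero x hx)
  step k := ⟨(T.step k).modulus, (T.step k).dvd_sub,
    fun x hx hx' => congrArg g ((T.step k).letter x hx hx')⟩

/-- Every element of the subshift of a sequence with a constant tower has a constant tower with the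
same periods and the same letters. -/
theorem IsConstantTower.exists_of_mem_subshift {A : Type*} [TopologicalSpace A]
    [DiscreteTopology A] {β ω : ℤ → A} {p : ℕ → ℕ} {h : ℕ → ℤ} {z : ℕ → A}
    (T : IsConstantTower β p h z) (hω : ω ∈ subshift β) : ∃ h', IsConstantTower ω p h' z := by
  have hne : NeBot (comap (fun (n : ℤ) (x : ℤ) => β (x + n)) (nhds ω)) := by
    rw [comap_neBot_iff]
    intro t ht
    obtain ⟨y, hy, n, rfl⟩ := mem_closure_iff_nhds.1 hω t ht
    exact ⟨n, hy⟩
  -- An ultrafilter of shifts converging to `ω` settles the residue of the shift modulo every `p k`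
  -- at once. Each tower property involves finitely many sites and levels, so it is read off from a
  -- single shift.
  set U := Ultrafilter.of (comap (fun (n : ℤ) (x : ℤ) => β (x + n)) (nhds ω))
  have hU : Tendsto (fun (n : ℤ) (x : ℤ) => β (x + n)) U (nhds ω) :=
    tendsto_comap.mono_left (Ultrafilter.of_le _)
  have hev : ∀ x, ∀ᶠ n in U, β (x + n) = ω x := by
    intro x
    have := (tendsto_pi_nhds.1 hU x).eventually ((isOpen_discrete {ω x}).mem_nhds rfl)
    exact this
  have hres : ∀ k, ∃ r : ℤ, ∀ᶠ n in U, (p k : ℤ) ∣ n - r := by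
    intro k
    have hp : (0 : ℤ) < p k := by exact_mod_cast T.pos k
    have hcov : (⋃ r ∈ Set.Ico (0 : ℤ) (p k), {n : ℤ | (p k : ℤ) ∣ n - r}) ∈ U := by
      refine Filter.univ_mem' fun n => ?_
      simp only [Set.mem_iUnion]
      exact ⟨n % p k, ⟨Int.emod_nonneg _ hp.ne', Int.emod_lt_of_pos _ hp⟩, Int.dvd_self_sub_emod⟩
    obtain ⟨r, -, hr⟩ := (Ultrafilter.finite_biUnion_mem_iff (Set.finite_Ico _ _)).1 hcov
    exact ⟨r, hr⟩
  choose r hr using hres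
  have hshift : ∀ k n x, (p k : ℤ) ∣ n - r k →
      ((p k : ℤ) ∣ x - (h k - r k) ↔ (p k : ℤ) ∣ x + n - h k) := by
    intro k n x hn
    have e : x + n - h k = x - (h k - r k) + (n - r k) := by ring
    rw [e, dvd_add_left hn]
  refine ⟨fun k => h k - r k, T.pos_zero, fun x hx => ?_, fun k => ⟨T.exists_mul k, ?_, ?_⟩⟩
  · obtain ⟨n, hn0, hn1, hn2⟩ := ((hr 0).and ((hev x).and (hev (x + p 0)))).exists
    rw [hshift 0 n x hn0] at hx
    rw [← hn1, ← hn2, ← T.periodic_zero _ hx]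
    congr 1
    ring
  · obtain ⟨n, hn0, hn1⟩ := ((hr k).and (hr (k + 1))).exists
    have h1 : (p k : ℤ) ∣ h (k + 1) - h k := (T.step k).dvd_sub
    have h2 := dvd_sub hn0 ((T.dvd_succ k).trans hn1)
    have h3 := dvd_sub h1 h2
    have e : h (k + 1) - h k - (n - r k - (n - r (k + 1)))
      = h (k + 1) - r (k + 1) - (h k - r k) := by ring
    rwa [e] at h3
  · intro x hx hx'
    obtain ⟨n, hn0, hn1, hn2⟩ := ((hr k).and ((hr (k + 1)).and (hev x))).exists
    simp only at hx hx'
    rw [hshift k n x hn0] at hx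
    rw [hshift (k + 1) n x hn1] at hx'
    rw [← hn2]
    exact T.letter hx hx'

/-! ### Real eigenvalues and the conclusion -/

/-- The eigenvalues of a Schrödinger operator are real. -/
theorem im_eq_zero_of_eigen {v : ℤ → ℝ} {F : ℤ → ℂ} {E : ℂ}
    (hF : ∀ x, F (x + 1) + F (x - 1) + (v x : ℂ) * F x = E * F x)
    (hs : Summable fun x => ‖F x‖ ^ 2) (hne : F ≠ 0) : E.im = 0 := by
  -- This is the current: its increments are `E.im * ‖F x‖ ^ 2`, and they sum to zero because `J` is
  -- summable.
  set J : ℤ → ℝ := fun x => (F (x + 1) * (starRingEnd ℂ) (F x)).im with hJ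
  have hs' : Summable fun x => ‖F (x + 1)‖ ^ 2 :=
    (Equiv.addRight (1 : ℤ)).summable_iff (f := fun x => ‖F x‖ ^ 2) |>.2 hs
  have hJs : Summable J := by
    refine Summable.of_norm_bounded (hs'.add hs) fun x => ?_
    rw [Real.norm_eq_abs]
    refine (Complex.abs_im_le_norm _).trans ?_
    rw [norm_mul, RCLike.norm_conj]
    nlinarith [sq_nonneg (‖F (x + 1)‖ - ‖F x‖), sq_nonneg (‖F (x + 1)‖ + ‖F x‖)]
  have hJs' : Summable fun x => J (x - 1) :=
    (Equiv.subRight (1 : ℤ)).summable_iff (f := J) |>.2 hJs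
  have hdiff : ∀ x, J x - J (x - 1) = E.im * ‖F x‖ ^ 2 := by
    intro x
    have h1 := congrArg Complex.im (congrArg (· * (starRingEnd ℂ) (F x)) (hF x))
    simp only [hJ, sub_add_cancel]
    rw [← Complex.normSq_eq_norm_sq, Complex.normSq_apply]
    simp only [Complex.mul_im, Complex.mul_re, Complex.add_im, Complex.add_re, Complex.conj_re,
      Complex.conj_im, Complex.ofReal_re, Complex.ofReal_im] at h1 ⊢
    linear_combination h1
  have hsum : ∑' x, (J x - J (x - 1)) = 0 := by
    rw [hJs.tsum_sub hJs', sub_eq_zero]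
    exact ((Equiv.subRight (1 : ℤ)).tsum_eq J).symm
  simp only [hdiff] at hsum
  rw [tsum_mul_left, mul_eq_zero] at hsum
  refine hsum.resolve_right fun h0 => hne ?_
  funext x
  have h1 := hs.le_tsum x fun y _ => sq_nonneg ‖F y‖
  rw [h0] at h1
  exact norm_eq_zero.1 (pow_eq_zero_iff two_ne_zero |>.1 (le_antisymm h1 (sq_nonneg _)))

theorem propositionp (A : Finset ℝ) (hA : A.card = 2) (β : ℤ → A)
    (hT : IsToeplitzWord β) (hS : IsPatternSturmian β)
    (ω : ℤ → A) (hω : ω ∈ subshift β) :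
    pointSpectrum (schrodinger ω) = ∅ := by
  obtain ⟨hrec, hap, hpc⟩ := hS
  obtain ⟨p, h₀, z, T₀⟩ := hT.exists_constantTower hap fun n hn => (hpc n hn).le
  have h2 : ∀ a b b' : A, b ≠ a → b' ≠ a → b = b' := by
    obtain ⟨s, t, hst, rfl⟩ := Finset.card_eq_two.1 hA
    rintro ⟨a, ha⟩ ⟨b, hb⟩ ⟨b', hb'⟩
    simp only [Finset.mem_insert, Finset.mem_singleton] at ha hb hb'
    simp only [ne_eq, Subtype.mk.injEq]
    grind
  have hletter := T₀.exists_letter_eq hap hrec h2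
  obtain ⟨h, T⟩ := T₀.exists_of_mem_subshift hω
  refine Set.eq_empty_iff_forall_notMem.2 fun E hE => ?_
  obtain ⟨f, hf⟩ := Module.End.HasEigenvalue.exists_hasEigenvector hE
  have hfE : ∀ x : ℤ, f (x + 1) + f (x - 1) + ((ω x : ℝ) : ℂ) * f x = E * f x := by
    intro x
    have := congrArg (fun g : EllTwo => g x) hf.apply_eq_smul
    simpa [schrodinger] using this
  have hsum : Summable fun x => ‖f x‖ ^ 2 := by
    have := lp.memℓp f
    rw [memℓp_gen_iff (by norm_num)] at this
    simpa using this
  have hne : (f : ℤ → ℂ) ≠ 0 := fun h0 => hf.2 (lp.ext h0)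
  have him := im_eq_zero_of_eigen (v := fun x => (ω x : ℝ)) hfE hsum hne
  -- For real `E`, the real and imaginary parts of an eigenvector solve the same real equation,
  -- whose coefficient `E.re - ω` inherits the tower of `ω`.
  have hzero : ∀ g : ℤ → ℝ, (∀ x, |g x| ≤ ‖f x‖) →
      IsSolution (fun x => E.re - (ω x : ℝ)) g → g = 0 := by
    intro g hg hsol
    refine (T.map fun a : A => E.re - (a : ℝ)).solution_eq_zero ?_ ?_ hsol ?_
    · intro k x y hx hy
      have : ω x = ω y := h2 (z k) _ _ (fun h => hx (by rw [h])) (fun h => hy (by rw [h]))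
      simp only [this]
    · intro x K
      obtain ⟨k, hk, hzk⟩ := hletter (ω x) K
      exact ⟨k, hk, by rw [hzk]⟩
    · refine Summable.of_nonneg_of_le (fun x => sq_nonneg _) (fun x => ?_) hsum
      rw [← sq_abs]
      exact pow_le_pow_left₀ (abs_nonneg _) (hg x) 2
  have hre := hzero (fun x => (f x).re) (fun x => Complex.abs_re_le_norm _) fun x => by
    have := congrArg Complex.re (hfE x)
    simp only [Complex.add_re, Complex.mul_re, Complex.ofReal_re, Complex.ofReal_im, him] at this
    simp only
    linear_combination this
  have himz := hzero (fun x => (f x).im) (fun x => Complex.abs_im_le_norm _) fun x => by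
    have := congrArg Complex.im (hfE x)
    simp only [Complex.add_im, Complex.mul_im, Complex.ofReal_re, Complex.ofReal_im, him] at this
    simp only
    linear_combination this
  exact hne (funext fun x => Complex.ext (congrFun hre x) (congrFun himz x))
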